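/- **Setting.** Let $k\ge 12^6$ be an integer and $\varepsilon=1/\sqrt k$. Define two distributions on $\{0,1\}^k$. $\mathcal D_1$: with probability $1-\varepsilon$ a uniformly random one of the $k$ bits is $1$ and all others are $0$; and for each $i=1,2,3,4$, with probability $\varepsilon/4$, the bits are independent and each is $1$ with probability $i/k^{1/3}$. $\mathcal D_0$: with probability $1-(\varepsilon_1+\varepsilon_2+\varepsilon_3+\varepsilon_4)$ all bits are $0$; and for each $i=1,2,3,4$, with probability $\varepsilon_i$, the bits are independent and each is $1$ with probability $i/k^{1/3}$. Here $\varepsilon_i=\varepsilon/4+c_i(1-\varepsilon)k^{-2/3}$ with $(c_1,c_2,c_3,c_4)=(4,-3,\tfrac43,-\tfrac14)$, which is the unique choice for which the moments of $\mathcal D_0$ and $\mathcal D_1$ up to degree $4$ agree. (The condition $k\ge 12^6$ ensures that all the weights are nonnegative.) An instance $\mathcal L$ of $k$-Label Cover consists of positive integers $M\ge N$, a finite connected $k$-uniform multi-hypergraph $(V,E)$ with $E\neq\emptyset$, whose hyperedges are written as tuples $e=(v_1,\dots,v_k)$ of distinct vertices, and projections $\pi^{v_i,e}:[M]\to[N]$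 for all $e\in E$ and $i\in[k]$. A labeling $\Lambda:V\to[M]$ strongly satisfies $e$ if $\pi^{v_i,e}(\Lambda(v_i))=\pi^{v_j,e}(\Lambda(v_j))$ for all $i,j$, and weakly satisfies $e$ if this equality holds for some $v_i\ne v_j$ in $e$. $\mathcal L$ is strongly satisfiable if some labeling strongly satisfies all hyperedges, and $\alpha$-weakly satisfiable if some labeling weakly satisfies at least an $\alpha$ fraction of the hyperedges. $\mathcal L$ is smooth with parameters $J,d$ if (i) for every vertex $v$ and all $i\neq j$ in $[M]$, a uniformly random hyperedge $e$ containing $v$ satisfies $\pi^{v,e}(i)=\pi^{v,e}(j)$ with probability at most $1/J$, and (ii) $|(\pi^{v,e})^{-1}(n)|\le d$ for every projection $\pi^{v,e}$ and every $n\in[N]$. The reduction maps $\mathcal L$ to the following distribution $\mathcal E$ on labeled examples $(y,b)\in\{0,1\}^{V\times[M]}\times\{0,1\}$. Pick a uniformly random hyperedge $e=(v_1,\dots,v_k)\in E$ and a uniformly random bit $b$. Draw $x^{(n)}=(x^{(n)}_1,\dots,x^{(n)}_k)$ independently from $\mathcal D_b$ for each $n\in[N]$. Put $y_v=\vec 0$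 for every $v\notin e$. Independently for all $i\in[k]$ and $j\in[M]$, let $y_{v_i}^{(j)}$ be $x_i^{(\pi^{v_i,e}(j))}$ with probability $1-1/k^2$ and a uniformly random bit with probability $1/k^2$. Output $(y,b)$. A halfspace is a function $y\mapsto\mathrm{sgn}(\langle w,y\rangle-\theta)$ with $w\in\mathbb R^{V\times[M]}$ and $\theta\in\mathbb R$, where $\mathrm{sgn}(t)=1$ if $t\ge0$ and $\mathrm{sgn}(t)=0$ if $t<0$. A disjunction is a function $\bigvee_{c\in S}s_c$, where $S\subseteq V\times[M]$ and each $s_c$ is $y_c$ or $\neg y_c$. A function $h$ agrees with $(y,b)$ if $h(y)=b$. **Theorem.** * *Completeness.* There is an absolute constant $C$ such that for every integer $k\ge 12^6$ and every strongly satisfiable instance $\mathcal L$ of $k$-Label Cover (smooth or not), some disjunction agrees with a random example from $\mathcal E$ with probability at least $1-C/\sqrt k$. * *Soundness.* For every constant $\gamma>0$ there is a constant $C$, depending only on $\gamma$, such that for every integer $k\ge 12^6$ and every instance $\mathcal L$ of $k$-Label Cover that is smooth with parameters $J=4^{17k}$ and $d=4^k$ and is not $2k^22^{-\gamma k}$-weakly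 satisfiable, no halfspace agrees with a random example from $\mathcal E$ with probability more than $\frac12+C/\sqrt k$. -/

import Mathlib

namespace AgnosticHardness

/-! ### Finite probability -/

/-- The probability mass function on a finite type with the given nonnegative real weights. -/
noncomputable def pmfOfReal {α : Type*} [Fintype α] (w : α → ℝ) (h0 : ∀ a, 0 ≤ w a)
    (h1 : ∑ a, w a = 1) : PMF α :=
  PMF.ofFintype (fun a => ENNReal.ofReal (w a)) (by
    rw [← ENNReal.ofReal_sum_of_nonneg (fun a _ => h0 a), h1, ENNReal.ofReal_one])

/-- A random bit that is `true` with probability `q`. -/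
noncomputable def biasedBit (q : ℝ) (h0 : 0 ≤ q) (h1 : q ≤ 1) : PMF Bool :=
  pmfOfReal (fun b => if b then q else 1 - q)
    (by intro b; cases b <;> simp [h0, h1]) (by simp)

/-- The product distribution: the coordinates `f i` are independent and `f i` has law `p i`. -/
noncomputable def piPMF {ι α : Type*} [Fintype ι] [Fintype α] (p : ι → PMF α) : PMF (ι → α) := by
  classical
  exact PMF.ofFintype (fun f => ∏ i, p i (f i)) (by
    have h := Finset.prod_univ_sum (fun _ : ι => (Finset.univ : Finset α)) (fun i a => p i a)
    rw [Fintype.piFinset_univ] at h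
    rw [← h]
    refine Finset.prod_eq_one fun i _ => ?_
    exact (tsum_fintype (fun a => p i a)).symm.trans (p i).tsum_coe)

/-! ### The two distributions on `{0,1}^k` with matching moments -/

/-- `ε = 1 / √k`. -/
noncomputable def eps (k : ℕ) : ℝ := 1 / Real.sqrt k

/-- The biases `1 / k^{1/3}, 2 / k^{1/3}, 3 / k^{1/3}, 4 / k^{1/3}`, indexed by `i = 0, 1, 2, 3`. -/
noncomputable def bias (k : ℕ) (i : Fin 4) : ℝ := ((i : ℕ) + 1 : ℝ) / (k : ℝ) ^ (1 / 3 : ℝ)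

/-- The weights `ε₁, ε₂, ε₃, ε₄` used by the distribution for label `0`.  They are the unique
solution of the linear system `∑ i, ε_i (i / k^{1/3})^m = [m = 1] (1 - ε) / k
+ ∑ i, (ε / 4) (i / k^{1/3})^m` for `m = 1, 2, 3, 4`, that is
`ε_i = ε / 4 + c_i (1 - ε) / k^{2/3}` with `c = (4, -3, 4/3, -1/4)`. -/
noncomputable def negWeight (k : ℕ) (i : Fin 4) : ℝ :=
  eps k / 4 + ![4, -3, 4 / 3, -(1 / 4)] i * ((1 - eps k) / (k : ℝ) ^ (2 / 3 : ℝ))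

/-- Mixture weights for label `1`: `1 - ε` for the component `none`, `ε / 4` for `some i`. -/
noncomputable def mixOne (k : ℕ) : Option (Fin 4) → ℝ
  | none => 1 - eps k
  | some _ => eps k / 4

/-- Mixture weights for label `0`: `1 - (ε₁ + ε₂ + ε₃ + ε₄)` for the component `none`,
`ε_i` for `some i`. -/
noncomputable def mixZero (k : ℕ) : Option (Fin 4) → ℝ
  | none => 1 - ∑ i, negWeight k i
  | some i => negWeight k i

theorem eps_nonneg (k : ℕ) : 0 ≤ eps k := by unfold eps; positivity

theorem eps_le {k : ℕ} (hk : 12 ^ 6 ≤ k) : eps k ≤ 1 / 1728 := by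
  have h : (1728 : ℝ) ≤ Real.sqrt k := by
    apply Real.le_sqrt_of_sq_le
    have : ((12 ^ 6 : ℕ) : ℝ) ≤ k := by exact_mod_cast hk
    norm_num at this ⊢
    exact this
  unfold eps
  exact one_div_le_one_div_of_le (by norm_num) h

theorem inv_le {k : ℕ} (hk : 12 ^ 6 ≤ k) : 1 / (k : ℝ) ^ (2 / 3 : ℝ) ≤ eps k / 12 := by
  have hk' : ((12 : ℝ) ^ (6 : ℕ)) ≤ k := by exact_mod_cast hk
  have hpos : (0 : ℝ) < k := lt_of_lt_of_le (by norm_num) hk'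
  have h12 : (12 : ℝ) ≤ (k : ℝ) ^ (1 / 6 : ℝ) := by
    calc (12 : ℝ) = ((12 : ℝ) ^ (6 : ℕ)) ^ (1 / 6 : ℝ) := by
          rw [← Real.rpow_natCast, ← Real.rpow_mul (by norm_num)]; norm_num
      _ ≤ _ := Real.rpow_le_rpow (by norm_num) hk' (by norm_num)
  have hs : (k : ℝ) ^ (2 / 3 : ℝ) = Real.sqrt k * (k : ℝ) ^ (1 / 6 : ℝ) := by
    rw [Real.sqrt_eq_rpow, ← Real.rpow_add hpos]; norm_num
  have hsq : 0 < Real.sqrt k := Real.sqrt_pos.2 hpos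
  unfold eps
  rw [hs, div_div]
  exact one_div_le_one_div_of_le (by positivity) (by gcongr)

theorem gap_bounds {k : ℕ} (hk : 12 ^ 6 ≤ k) :
    0 ≤ (1 - eps k) / (k : ℝ) ^ (2 / 3 : ℝ) ∧
      (1 - eps k) / (k : ℝ) ^ (2 / 3 : ℝ) ≤ eps k / 12 := by
  have h1 := eps_le hk
  have h0 := eps_nonneg k
  refine ⟨div_nonneg (by linarith) (by positivity), le_trans ?_ (inv_le hk)⟩
  gcongr
  linarith

theorem negWeight_nonneg {k : ℕ} (hk : 12 ^ 6 ≤ k) (i : Fin 4) : 0 ≤ negWeight k i := by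
  obtain ⟨h0, h1⟩ := gap_bounds hk
  have := eps_nonneg k
  unfold negWeight
  fin_cases i <;> simp <;> linarith

theorem mixOne_nonneg {k : ℕ} (hk : 12 ^ 6 ≤ k) (o : Option (Fin 4)) : 0 ≤ mixOne k o := by
  have h1 := eps_le hk
  have h0 := eps_nonneg k
  cases o <;> simp only [mixOne] <;> linarith

theorem mixZero_nonneg {k : ℕ} (hk : 12 ^ 6 ≤ k) (o : Option (Fin 4)) : 0 ≤ mixZero k o := by
  obtain ⟨h0, h1⟩ := gap_bounds hk
  have he := eps_le hk
  cases o with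
  | none =>
    simp only [mixZero, negWeight, Fin.sum_univ_four]
    simp
    linarith
  | some i => exact negWeight_nonneg hk i

theorem mixOne_sum (k : ℕ) : ∑ o, mixOne k o = 1 := by
  simp only [Fintype.sum_option, mixOne, Finset.sum_const, Finset.card_univ, Fintype.card_fin]
  ring

theorem mixZero_sum (k : ℕ) : ∑ o, mixZero k o = 1 := by
  simp only [Fintype.sum_option, mixZero]
  ring

theorem bias_nonneg (k : ℕ) (i : Fin 4) : 0 ≤ bias k i := by unfold bias; positivity

theorem bias_le_one {k : ℕ} (hk : 12 ^ 6 ≤ k) (i : Fin 4) : bias k i ≤ 1 := by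
  have hk' : ((12 : ℝ) ^ (6 : ℕ)) ≤ k := by exact_mod_cast hk
  have h : (4 : ℝ) ≤ (k : ℝ) ^ (1 / 3 : ℝ) := by
    calc (4 : ℝ) = ((4 : ℝ) ^ (3 : ℕ)) ^ (1 / 3 : ℝ) := by
          rw [← Real.rpow_natCast, ← Real.rpow_mul (by norm_num)]; norm_num
      _ ≤ _ := Real.rpow_le_rpow (by norm_num) (le_trans (by norm_num) hk') (by norm_num)
  have hi : ((i : ℕ) : ℝ) + 1 ≤ 4 := by
    have : (i : ℕ) + 1 ≤ 4 := i.2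
    exact_mod_cast this
  unfold bias
  rw [div_le_one (by linarith)]
  linarith

theorem nonempty_fin {k : ℕ} (hk : 12 ^ 6 ≤ k) : Nonempty (Fin k) :=
  ⟨⟨0, lt_of_lt_of_le (by norm_num) hk⟩⟩

/-- `k` independent bits, each equal to `1` with probability `bias k i`. -/
noncomputable def iidBits {k : ℕ} (hk : 12 ^ 6 ≤ k) (i : Fin 4) : PMF (Fin k → Bool) :=
  piPMF fun _ => biasedBit (bias k i) (bias_nonneg k i) (bias_le_one hk i)

/-- The distribution `𝒟₁`: with probability `1 - ε` a uniformly random bit is set to `1` and all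
others to `0`; with probability `ε / 4` each, all bits are independent with bias `i / k^{1/3}`. -/
noncomputable def distOne {k : ℕ} (hk : 12 ^ 6 ≤ k) : PMF (Fin k → Bool) :=
  (pmfOfReal (mixOne k) (mixOne_nonneg hk) (mixOne_sum k)).bind fun o =>
    match o with
    | none => (@PMF.uniformOfFintype (Fin k) _ (nonempty_fin hk)).map fun p q => decide (q = p)
    | some i => iidBits hk i

/-- The distribution `𝒟₀`: with probability `1 - (ε₁ + ε₂ + ε₃ + ε₄)` all bits are `0`; with
probability `ε_i`, all bits are independent with bias `i / k^{1/3}`. -/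
noncomputable def distZero {k : ℕ} (hk : 12 ^ 6 ≤ k) : PMF (Fin k → Bool) :=
  (pmfOfReal (mixZero k) (mixZero_nonneg hk) (mixZero_sum k)).bind fun o =>
    match o with
    | none => PMF.pure fun _ => false
    | some i => iidBits hk i

/-- `𝒟_b` for `b ∈ {0,1}`. -/
noncomputable def testDist {k : ℕ} (hk : 12 ^ 6 ≤ k) (b : Bool) : PMF (Fin k → Bool) :=
  if b then distOne hk else distZero hk

theorem noise_le_one (k : ℕ) : 1 / (k : ℝ) ^ 2 ≤ 1 := by
  rcases Nat.eq_zero_or_pos k with h | h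
  · simp [h]
  · have : (1 : ℝ) ≤ k := by exact_mod_cast h
    rw [div_le_one (by positivity)]
    nlinarith

/-- The bit `x`, replaced with probability `1 / k²` by a uniformly random bit. -/
noncomputable def noisyBit (k : ℕ) (x : Bool) : PMF Bool :=
  (biasedBit (1 / (k : ℝ) ^ 2) (by positivity) (noise_le_one k)).bind fun r =>
    if r then PMF.uniformOfFintype Bool else PMF.pure x

/-! ### `k`-Label Cover -/

/-- An instance of `k`-Label Cover with vertex set `V`, hyperedges indexed by `E` (so that a
hyperedge may occur several times) and label sets `[M]`, `[N]`.  The `p`-th vertex of the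
hyperedge `e` is `vert e p`, and `proj e p` is the projection of that vertex for `e`. -/
structure KLabelCover (k M N : ℕ) (V E : Type*) where
  two_le_k : 2 ≤ k
  N_pos : 0 < N
  N_le_M : N ≤ M
  nonempty_edges : Nonempty E
  vert : E → Fin k → V
  vert_injective : ∀ e, Function.Injective (vert e)
  proj : E → Fin k → Fin M → Fin N
  /-- Any two vertices are joined by a chain of vertices in which neighbours share a hyperedge. -/
  connected : ∀ u v : V,
    Relation.ReflTransGen (fun a b => ∃ e p q, vert e p = a ∧ vert e q = b) u v

namespace KLabelCover

variable {k M N : ℕ} {V E : Type*} (L : KLabelCover k M N V E)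

/-- The labeling `Λ` strongly satisfies the hyperedge `e`. -/
def StronglySatisfies (Λ : V → Fin M) (e : E) : Prop :=
  ∀ p q, L.proj e p (Λ (L.vert e p)) = L.proj e q (Λ (L.vert e q))

/-- The labeling `Λ` weakly satisfies the hyperedge `e`. -/
def WeaklySatisfies (Λ : V → Fin M) (e : E) : Prop :=
  ∃ p q, L.vert e p ≠ L.vert e q ∧ L.proj e p (Λ (L.vert e p)) = L.proj e q (Λ (L.vert e q))

/-- Some labeling strongly satisfies every hyperedge. -/
def StronglySatisfiable : Prop :=
  ∃ Λ : V → Fin M, ∀ e, L.StronglySatisfies Λ e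

open scoped Classical in
/-- Some labeling weakly satisfies at least an `α` fraction of the hyperedges. -/
def WeaklySatisfiable [Fintype E] (α : ℝ) : Prop :=
  ∃ Λ : V → Fin M,
    α ≤ ((Finset.univ.filter fun e => L.WeaklySatisfies Λ e).card : ℝ) / Fintype.card E

open scoped Classical in
/-- Smoothness with parameters `J` and `d`: for every vertex `v` and distinct labels `i`, `j`, a
uniformly random hyperedge `e` containing `v` satisfies `π^{v,e}(i) = π^{v,e}(j)` with probability
at most `1 / J`; and every projection maps at most `d` labels to the same value.  A hyperedge
containing `v` is counted through the unique pair `(e, p)` with `vert e p = v`. -/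
def Smooth [Fintype E] (J d : ℕ) : Prop :=
  (∀ (v : V) (i j : Fin M), i ≠ j →
    ((Finset.univ.filter fun c : E × Fin k =>
        L.vert c.1 c.2 = v ∧ L.proj c.1 c.2 i = L.proj c.1 c.2 j).card : ℝ) /
      (Finset.univ.filter fun c : E × Fin k => L.vert c.1 c.2 = v).card ≤ 1 / (J : ℝ)) ∧
  ∀ (e : E) (p : Fin k) (n : Fin N),
    (Finset.univ.filter fun m : Fin M => L.proj e p m = n).card ≤ d

/-- The distribution `ℰ` on labeled examples `(y, b)`: pick a uniformly random hyperedge `e` and a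
uniformly random bit `b`; draw `x n ∈ {0,1}^k` independently from `𝒟_b` for each `n ∈ [N]`; for the
`p`-th vertex of `e` and `j ∈ [M]` let `z p j` be an independently noised copy of the `p`-th bit of
`x (π(j))`; the block of `y` at the `p`-th vertex of `e` is `z p`, and the blocks of all vertices
outside `e` are zero. -/
noncomputable def exampleDist [Fintype E] (hk : 12 ^ 6 ≤ k) :
    PMF ((V × Fin M → Bool) × Bool) :=
  (@PMF.uniformOfFintype E _ L.nonempty_edges).bind fun e =>
  (PMF.uniformOfFintype Bool).bind fun b =>
  (piPMF fun _ : Fin N => testDist hk b).bind fun x =>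
  (piPMF fun p : Fin k => piPMF fun j : Fin M => noisyBit k (x (L.proj e p j) p)).bind fun z =>
  PMF.pure (fun c => Function.extend (L.vert e) z (fun _ _ => false) c.1 c.2, b)

end KLabelCover

/-! ### Hypotheses -/

/-- Disjunctions `⋁_{i ∈ S} s_i` of literals; `s_i` is `x_i` if `sign i = true`, otherwise `¬ x_i`. -/
def IsDisjunction {ι : Type*} (h : (ι → Bool) → Bool) : Prop :=
  ∃ (S : Finset ι) (sign : ι → Bool), ∀ y, h y = true ↔ ∃ i ∈ S, y i = sign i

/-- Halfspaces `sgn(⟨w, y⟩ - θ)`, where `sgn t = 1` if `t ≥ 0` and `sgn t = 0` otherwise. -/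
def IsHalfspace {ι : Type*} [Fintype ι] (h : (ι → Bool) → Bool) : Prop :=
  ∃ (w : ι → ℝ) (θ : ℝ), ∀ y, h y = true ↔ 0 ≤ (∑ i, w i * (if y i then 1 else 0)) - θ

/-- The probability that `h` agrees with a random labeled example. -/
noncomputable def agreement {ι : Type*} (P : PMF ((ι → Bool) × Bool)) (h : (ι → Bool) → Bool) : ℝ :=
  (P.toOuterMeasure {z | h z.1 = z.2}).toReal

end AgnosticHardness

/-! Completeness. Under a strongly satisfying labeling, the coordinates `(v, Λ v)` at the vertices
of a hyperedge all read the same string `x n₀`. Up to noise, the disjunction of these coordinates is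
therefore the OR of that string, which is 1 on a planted single one and 0 on the zero string. The
only losses are the weight of the independent components (at most `2ε`) and the noise on `k`
coordinates (at most `k · k⁻²`).

Soundness. It must be shown that a halfspace accepts with almost equal probability under both
labels, on average over hyperedges. Each vertex gets the list of its `k ^ 14` labels of largest
absolute weight (the heavy ones). If the lists of two vertices of a hyperedge meet after projection,
a labeling drawn at random from the lists weakly satisfies it with probability at least `k ^ (-28)`,
so failure of weak satisfiability makes such hyperedges exponentially rare (`exists_labeling`).

On the other hyperedges a Lindeberg exchange works. The threshold is replaced by a smooth step, the
noise is frozen, and the strings are exchanged one at a time. For each `n` only one vertex `q` has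
heavy labels above `n`, so the form is `c + a x_q + ℓ(x)` with `ℓ` light. Expand to third order in
`ℓ` around `c + a x_q`. Each coefficient depends on the single bit `x_q`, hence is affine in it,
however large `a` is. The Taylor polynomial thus has degree at most 4 in the bits, and the four
matching moments remove it (`abs_expect_testDist_sub_le`, `abs_blockExpect_sub_le`). The remainders
`ℓ⁴` sum to fourth powers of light weights plus contributions of pairs of labels with equal
projection, which smoothness makes negligible on average (`sum_collisionRatio_le`).

Smoothing costs the probability of landing within 1 of the threshold, and the noise alone makes it
small. Rescale until the light weights either have square sum `k ^ 4` or have maximum `k ^ (-5)`,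
neither bound being exceeded. In the first case the light coordinates spread the form; in the
second, `k ^ 14` heavy ones of size at least `k ^ (-5)` do. Both cases are Fourier estimates and
give `O(1/k)` (`blockExpect_smallBall_le`). -/

namespace AgnosticHardness

/-! ### Expectations over finite probability spaces -/

section Expectation

variable {α β F : Type*} [NormedAddCommGroup F] [NormedSpace ℝ F]

/-- The expectation of `f` under `p`. -/
noncomputable def expect (p : PMF α) (f : α → F) : F := ∑' a, (p a).toReal • f a

theorem expect_eq_sum [Fintype α] (p : PMF α) (f : α → F) :
    expect p f = ∑ a, (p a).toReal • f a := tsum_fintype _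

theorem sum_toReal [Fintype α] (p : PMF α) : ∑ a, (p a).toReal = 1 := by
  have h := p.tsum_coe
  rw [tsum_fintype] at h
  rw [← ENNReal.toReal_sum fun a _ => p.apply_ne_top a, h, ENNReal.toReal_one]

theorem expect_const [Finite α] (p : PMF α) (c : F) : expect p (fun _ => c) = c := by
  have := Fintype.ofFinite α
  rw [expect_eq_sum, ← Finset.sum_smul, sum_toReal, one_smul]

theorem expect_add [Finite α] (p : PMF α) (f g : α → F) :
    expect p (fun a => f a + g a) = expect p f + expect p g := by
  have := Fintype.ofFinite α
  simp only [expect_eq_sum, smul_add, Finset.sum_add_distrib]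

theorem expect_sub [Finite α] (p : PMF α) (f g : α → F) :
    expect p (fun a => f a - g a) = expect p f - expect p g := by
  have := Fintype.ofFinite α
  simp only [expect_eq_sum, smul_sub, Finset.sum_sub_distrib]

theorem expect_mul_left [Finite α] (p : PMF α) (c : ℝ) (f : α → ℝ) :
    expect p (fun a => c * f a) = c * expect p f := by
  have := Fintype.ofFinite α
  simp only [expect_eq_sum, smul_eq_mul, Finset.mul_sum]
  exact Finset.sum_congr rfl fun a _ => by ring

theorem expect_sum [Finite α] {ι : Type*} (s : Finset ι) (p : PMF α) (f : ι → α → F) :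
    expect p (fun a => ∑ i ∈ s, f i a) = ∑ i ∈ s, expect p (f i) := by
  have := Fintype.ofFinite α
  simp only [expect_eq_sum, Finset.smul_sum]
  exact Finset.sum_comm

theorem expect_mono [Finite α] (p : PMF α) {f g : α → ℝ} (h : ∀ a, f a ≤ g a) :
    expect p f ≤ expect p g := by
  have := Fintype.ofFinite α
  simp only [expect_eq_sum, smul_eq_mul]
  exact Finset.sum_le_sum fun a _ => mul_le_mul_of_nonneg_left (h a) ENNReal.toReal_nonneg

theorem expect_nonneg [Finite α] (p : PMF α) {f : α → ℝ} (h : ∀ a, 0 ≤ f a) :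
    0 ≤ expect p f := (expect_const p (0 : ℝ)).symm.trans_le (expect_mono p h)

theorem expect_le [Finite α] (p : PMF α) {f : α → ℝ} {c : ℝ} (h : ∀ a, f a ≤ c) :
    expect p f ≤ c := (expect_mono p h).trans_eq (expect_const p c)

theorem le_expect [Finite α] (p : PMF α) {f : α → ℝ} {c : ℝ} (h : ∀ a, c ≤ f a) :
    c ≤ expect p f := (expect_const p c).symm.trans_le (expect_mono p h)

theorem abs_expect_le [Finite α] (p : PMF α) {f : α → ℝ} {c : ℝ} (h : ∀ a, |f a| ≤ c) :
    |expect p f| ≤ c :=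
  abs_le.2 ⟨le_expect p fun a => (abs_le.1 (h a)).1, expect_le p fun a => (abs_le.1 (h a)).2⟩

theorem expect_pure [Finite α] (a : α) (f : α → F) : expect (PMF.pure a) f = f a := by
  classical
  have := Fintype.ofFinite α
  rw [expect_eq_sum, Finset.sum_eq_single a]
  · simp
  · intro b _ hb
    simp [PMF.pure_apply, hb]
  · simp

theorem expect_bind [Finite α] [Finite β] (p : PMF α) (q : α → PMF β) (f : β → F) :
    expect (p.bind q) f = expect p fun a => expect (q a) f := by
  have := Fintype.ofFinite α
  have := Fintype.ofFinite β
  have h : ∀ b, ((p.bind q) b).toReal = ∑ a, (p a).toReal * (q a b).toReal := fun b => by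
    rw [PMF.bind_apply, tsum_fintype, ENNReal.toReal_sum fun a _ =>
      ENNReal.mul_ne_top (p.apply_ne_top a) ((q a).apply_ne_top b)]
    simp only [ENNReal.toReal_mul]
  simp only [expect_eq_sum, h, Finset.sum_smul, Finset.smul_sum, smul_smul]
  exact Finset.sum_comm

theorem expect_map [Finite α] [Finite β] (p : PMF α) (g : α → β) (f : β → F) :
    expect (p.map g) f = expect p fun a => f (g a) := by
  rw [PMF.map, expect_bind]
  simp only [Function.comp_apply, expect_pure]

theorem expect_pmfOfReal [Fintype α] {w : α → ℝ} (h0 : ∀ a, 0 ≤ w a) (h1 : ∑ a, w a = 1)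
    (f : α → F) : expect (pmfOfReal w h0 h1) f = ∑ a, w a • f a := by
  rw [expect_eq_sum]
  refine Finset.sum_congr rfl fun a _ => ?_
  rw [pmfOfReal, PMF.ofFintype_apply, ENNReal.toReal_ofReal (h0 a)]

theorem expect_biasedBit {q : ℝ} (h0 : 0 ≤ q) (h1 : q ≤ 1) (f : Bool → F) :
    expect (biasedBit q h0 h1) f = q • f true + (1 - q) • f false := by
  rw [biasedBit, expect_pmfOfReal, Fintype.sum_bool]
  simp

theorem expect_uniformOfFintype [Fintype α] [Nonempty α] (f : α → ℝ) :
    expect (PMF.uniformOfFintype α) f = (∑ a, f a) / Fintype.card α := by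
  rw [expect_eq_sum, div_eq_inv_mul, Finset.mul_sum]
  refine Finset.sum_congr rfl fun a _ => ?_
  simp [PMF.uniformOfFintype_apply]

theorem toOuterMeasure_toReal [Finite α] (p : PMF α) (s : Set α) :
    (p.toOuterMeasure s).toReal = expect p (s.indicator fun _ => (1 : ℝ)) := by
  classical
  have := Fintype.ofFinite α
  rw [PMF.toOuterMeasure_apply_fintype, expect_eq_sum, ENNReal.toReal_sum]
  · refine Finset.sum_congr rfl fun a _ => ?_
    by_cases h : a ∈ s <;> simp [h]
  · intro a _
    by_cases h : a ∈ s <;> simp [h, p.apply_ne_top a]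

/-! ### Product distributions -/

variable {ι : Type*} [Fintype ι]

theorem piPMF_apply [Fintype α] (p : ι → PMF α) (f : ι → α) : piPMF p f = ∏ i, p i (f i) := rfl

theorem expect_piPMF_prod [Fintype α] {𝕜 : Type*} [RCLike 𝕜] (p : ι → PMF α) (g : ι → α → 𝕜) :
    expect (piPMF p) (fun z => ∏ i, g i (z i)) = ∏ i, expect (p i) (g i) := by
  classical
  simp only [expect_eq_sum, piPMF_apply, ENNReal.toReal_prod, RCLike.real_smul_eq_coe_mul]
  rw [Finset.prod_univ_sum, Fintype.piFinset_univ]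
  refine Finset.sum_congr rfl fun z _ => ?_
  rw [Finset.prod_mul_distrib]
  push_cast
  rfl

theorem piPMF_map [Fintype α] [Fintype β] (p : ι → PMF α) (g : ι → α → β) :
    piPMF (fun i => (p i).map (g i)) = (piPMF p).map fun ρ i => g i (ρ i) := by
  classical
  ext z
  rw [piPMF_apply]
  simp only [PMF.map_apply, tsum_fintype, piPMF_apply]
  rw [Finset.prod_univ_sum, Fintype.piFinset_univ]
  refine Finset.sum_congr rfl fun ρ _ => ?_
  by_cases h : ∀ i, z i = g i (ρ i)
  · simp [funext h]
  · rw [if_neg fun hz => h fun i => congrFun hz i]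
    push Not at h
    obtain ⟨i, hi⟩ := h
    exact Finset.prod_eq_zero (Finset.mem_univ i) (if_neg hi)

/-- The old value at `i` is overwritten, so its law may be anything: once coordinate `i` is split
off from the sum, its probabilities add up to 1. -/
theorem expect_piPMF_update [Fintype α] [DecidableEq ι] (p : ι → PMF α) (i : ι) (q : PMF α)
    (f : (ι → α) → ℝ) :
    expect (piPMF (Function.update p i q)) f =
      expect (piPMF p) fun x => expect q fun y => f (Function.update x i y) := by
  classical
  have key : ∀ (r : PMF α) (g : (ι → α) → ℝ), expect (piPMF (Function.update p i r)) g =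
      ∑ y, (r y).toReal * ∑ x' : {j // j ≠ i} → α, (∏ j : {j // j ≠ i}, (p j (x' j)).toReal) *
        g ((Equiv.funSplitAt i α).symm (y, x')) := by
    intro r g
    rw [expect_eq_sum, ← (Equiv.funSplitAt i α).symm.sum_comp, Fintype.sum_prod_type]
    refine Finset.sum_congr rfl fun y _ => ?_
    rw [Finset.mul_sum]
    refine Finset.sum_congr rfl fun x' _ => ?_
    rw [piPMF_apply, ENNReal.toReal_prod, smul_eq_mul, ← mul_assoc,
      Fintype.prod_eq_mul_prod_subtype_ne _ i]
    congr 2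
    · simp [Equiv.funSplitAt_symm_apply]
    · refine Finset.prod_congr rfl fun j _ => ?_
      simp [Equiv.funSplitAt_symm_apply, j.2]
  have h2 : ∀ (y y' : α) (x' : {j // j ≠ i} → α),
      Function.update ((Equiv.funSplitAt i α).symm (y, x')) i y' =
        (Equiv.funSplitAt i α).symm (y', x') := by
    intro y y' x'
    ext j
    by_cases h : j = i
    · subst h; simp [Equiv.funSplitAt_symm_apply]
    · simp [Equiv.funSplitAt_symm_apply, h]
  have h3 := key (p i) fun x => expect q fun y => f (Function.update x i y)
  rw [Function.update_eq_self] at h3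
  rw [key, h3]
  simp only [h2]
  rw [← Finset.sum_mul, sum_toReal, one_mul]
  simp only [expect_eq_sum, smul_eq_mul, Finset.mul_sum]
  rw [Finset.sum_comm]
  exact Finset.sum_congr rfl fun x' _ => Finset.sum_congr rfl fun y _ => by ring

/-- Replacing the coordinates of a product distribution one at a time. -/
theorem abs_expect_piPMF_sub_le [Fintype α] [DecidableEq ι] (p q : ι → PMF α) (f : (ι → α) → ℝ)
    (δ : ι → ℝ)
    (h : ∀ i x, |expect (q i) (fun y => f (Function.update x i y)) -
      expect (p i) (fun y => f (Function.update x i y))| ≤ δ i) :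
    |expect (piPMF q) f - expect (piPMF p) f| ≤ ∑ i, δ i := by
  have key : ∀ s : Finset ι,
      |expect (piPMF (s.piecewise q p)) f - expect (piPMF p) f| ≤ ∑ i ∈ s, δ i := by
    intro s
    induction s using Finset.induction_on with
    | empty => simp
    | insert i s hi ih =>
      rw [Finset.sum_insert hi, Finset.piecewise_insert]
      have h1 := expect_piPMF_update (s.piecewise q p) i (q i) f
      have h2 := expect_piPMF_update (s.piecewise q p) i (p i) f
      have h3 : Function.update (s.piecewise q p) i (p i) = s.piecewise q p := by
        rw [← Finset.piecewise_eq_of_notMem s q p hi, Function.update_eq_self]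
      rw [h3] at h2
      have h4 : |expect (piPMF (Function.update (s.piecewise q p) i (q i))) f -
          expect (piPMF (s.piecewise q p)) f| ≤ δ i := by
        rw [h1, h2, ← expect_sub]
        exact abs_expect_le _ fun x => h i x
      exact (abs_sub_le _ _ _).trans (add_le_add h4 ih)
  simpa using key Finset.univ

end Expectation

section

theorem expect_piPMF_eval {ι α : Type*} [Fintype ι] [Fintype α] (p : ι → PMF α) (i : ι)
    (f : α → ℝ) : expect (piPMF p) (fun z => f (z i)) = expect (p i) f := by
  classical
  have h := expect_piPMF_prod p fun j a => if j = i then f a else (1 : ℝ)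
  rw [Finset.prod_eq_single_of_mem i (Finset.mem_univ i)] at h
  · simp only [if_true] at h
    rw [← h]
    congr 1
    ext z
    rw [Finset.prod_eq_single_of_mem i (Finset.mem_univ i)]
    · simp
    · intro j _ hj
      simp [hj]
  · intro j _ hj
    simp only [hj, if_false]
    exact expect_const _ _

/-! ### Moments of the two test distributions -/

/-- The real number `0` or `1` given by a bit. -/
def bit (b : Bool) : ℝ := if b then 1 else 0

@[simp] theorem bit_true : bit true = 1 := rfl
@[simp] theorem bit_false : bit false = 0 := rfl

theorem bit_mul_self (b : Bool) : bit b * bit b = bit b := by cases b <;> simp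

theorem abs_bit_le_one (b : Bool) : |bit b| ≤ 1 := by cases b <;> simp

variable {k : ℕ}

theorem expect_distOne (hk : 12 ^ 6 ≤ k) (f : (Fin k → Bool) → ℝ) :
    expect (distOne hk) f = (1 - eps k) * ((∑ p, f fun q => decide (q = p)) / k) +
      ∑ i, eps k / 4 * expect (iidBits hk i) f := by
  rw [distOne, expect_bind, expect_pmfOfReal, Fintype.sum_option]
  simp only [smul_eq_mul, mixOne]
  rw [expect_map, @expect_uniformOfFintype _ _ (nonempty_fin hk), Fintype.card_fin]

theorem expect_distZero (hk : 12 ^ 6 ≤ k) (f : (Fin k → Bool) → ℝ) :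
    expect (distZero hk) f = (1 - ∑ i, negWeight k i) * f (fun _ => false) +
      ∑ i, negWeight k i * expect (iidBits hk i) f := by
  rw [distZero, expect_bind, expect_pmfOfReal, Fintype.sum_option]
  simp only [smul_eq_mul, mixZero]
  rw [expect_pure]

theorem expect_iidBits_prod (hk : 12 ^ 6 ≤ k) (i : Fin 4) (s : Finset (Fin k)) :
    expect (iidBits hk i) (fun x => ∏ p ∈ s, bit (x p)) = bias k i ^ s.card := by
  have h := expect_piPMF_prod
    (fun _ : Fin k => biasedBit (bias k i) (bias_nonneg k i) (bias_le_one hk i))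
    fun p b => if p ∈ s then bit b else 1
  have h2 : ∀ p : Fin k, expect (biasedBit (bias k i) (bias_nonneg k i) (bias_le_one hk i))
      (fun b => if p ∈ s then bit b else 1) = if p ∈ s then bias k i else 1 := by
    intro p
    split_ifs
    · simp [expect_biasedBit]
    · exact expect_const _ _
  simp only [h2, Finset.prod_ite_mem, Finset.univ_inter, Finset.prod_const] at h
  exact h

/-- With `r = k^{1/3}`, the corrections `c_i (1 - ε) / r²` contribute `(1 - ε) r^{-2-m} ∑ c_i i^m`.
The coefficients solve `∑ c_i i^m = [m = 1]` for `1 ≤ m ≤ 4`, which leaves `(1 - ε) / r³ = (1 - ε) /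
k` for `m = 1` and nothing otherwise. -/
theorem negWeight_moment (hk : 12 ^ 6 ≤ k) (m : ℕ) (hm : 1 ≤ m) (hm4 : m ≤ 4) :
    ∑ i, negWeight k i * bias k i ^ m =
      (if m = 1 then (1 - eps k) / k else 0) + ∑ i, eps k / 4 * bias k i ^ m := by
  have hpos : (0 : ℝ) < k := by
    have : 0 < k := lt_of_lt_of_le (by norm_num) hk
    exact_mod_cast this
  set r : ℝ := (k : ℝ) ^ (1 / 3 : ℝ) with hr
  have hr0 : 0 < r := by positivity
  have h2 : (k : ℝ) ^ (2 / 3 : ℝ) = r ^ 2 := by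
    rw [hr, ← Real.rpow_natCast, ← Real.rpow_mul hpos.le]; norm_num
  have h3 : (k : ℝ) = r ^ 3 := by
    rw [hr, ← Real.rpow_natCast, ← Real.rpow_mul hpos.le]; norm_num
  simp only [negWeight, bias, Fin.sum_univ_four, h2, ← hr]
  generalize eps k = e
  rw [h3]
  interval_cases m <;> simp <;> field_simp <;> ring

/-- The zero string contributes nothing to a nonempty product. The planted one contributes only to a
single bit, since two distinct bits are never both 1; this is the bracket in `negWeight_moment`. -/
theorem expect_testDist_prod (hk : 12 ^ 6 ≤ k) (b : Bool) (s : Finset (Fin k)) (hs : s.Nonempty)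
    (hs4 : s.card ≤ 4) :
    expect (testDist hk b) (fun x => ∏ p ∈ s, bit (x p)) =
      ∑ i, negWeight k i * bias k i ^ s.card := by
  cases b with
  | false =>
    obtain ⟨p, hp⟩ := hs
    simp only [testDist, Bool.false_eq_true, if_false, expect_distZero, expect_iidBits_prod]
    rw [Finset.prod_eq_zero hp bit_false, mul_zero, zero_add]
  | true =>
    simp only [testDist, if_true, expect_distOne, expect_iidBits_prod]
    rw [negWeight_moment hk _ hs.card_pos hs4]
    congr 1
    split_ifs with h
    · obtain ⟨a, rfl⟩ := Finset.card_eq_one.1 h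
      simp [bit, div_eq_mul_inv]
    · rw [Finset.sum_eq_zero, zero_div, mul_zero]
      intro p _
      have : ∃ q ∈ s, q ≠ p := by
        by_contra! hc
        exact h (Finset.card_eq_one.2 ⟨p, Finset.eq_singleton_iff_nonempty_unique_mem.2 ⟨hs, hc⟩⟩)
      obtain ⟨q, hq, hqp⟩ := this
      exact Finset.prod_eq_zero hq (by simp [hqp])

/-- Bits are idempotent, so repeated indices only lower the degree, and one statement covers all
degrees from 1 to 4. -/
theorem expect_testDist_monomial (hk : 12 ^ 6 ≤ k) (p₁ p₂ p₃ p₄ : Fin k) :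
    expect (testDist hk true) (fun x => bit (x p₁) * bit (x p₂) * bit (x p₃) * bit (x p₄)) =
      expect (testDist hk false) (fun x => bit (x p₁) * bit (x p₂) * bit (x p₃) * bit (x p₄)) := by
  have hprod : ∀ (x : Fin k → Bool) (a : Fin k) (s : Finset (Fin k)),
      ∏ p ∈ insert a s, bit (x p) = bit (x a) * ∏ p ∈ s, bit (x p) := by
    intro x a s
    by_cases h : a ∈ s
    · rw [Finset.insert_eq_of_mem h, ← Finset.mul_prod_erase s _ h, ← mul_assoc, bit_mul_self]
    · rw [Finset.prod_insert h]
  have h : ∀ x : Fin k → Bool, bit (x p₁) * bit (x p₂) * bit (x p₃) * bit (x p₄) =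
      ∏ p ∈ ({p₁, p₂, p₃, p₄} : Finset (Fin k)), bit (x p) := by
    intro x
    simp only [hprod, Finset.prod_singleton, mul_assoc]
  have hc : ({p₁, p₂, p₃, p₄} : Finset (Fin k)).card ≤ 4 := Finset.card_le_four
  simp only [h]
  rw [expect_testDist_prod hk _ _ (by simp) hc, expect_testDist_prod hk _ _ (by simp) hc]

/-! ### Noise -/

/-- The law of a noise symbol: `none` keeps a bit, `some b` replaces it by `b`. -/
noncomputable def noiseLaw (k : ℕ) : PMF (Option Bool) :=
  (biasedBit (1 / (k : ℝ) ^ 2) (by positivity) (noise_le_one k)).bind fun r =>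
    if r then (PMF.uniformOfFintype Bool).map some else PMF.pure none

theorem noisyBit_eq_map (k : ℕ) (x : Bool) : noisyBit k x = (noiseLaw k).map fun ρ => ρ.getD x := by
  rw [noisyBit, noiseLaw, PMF.map_bind]
  congr 1
  ext1 r
  cases r
  · simp [PMF.pure_map]
  · simp only [if_true, PMF.map_comp]
    exact (PMF.map_id _).symm

theorem expect_noiseLaw_isSome (k : ℕ) :
    expect (noiseLaw k) (fun ρ => if ρ.isSome then (1 : ℝ) else 0) = 1 / (k : ℝ) ^ 2 := by
  rw [noiseLaw, expect_bind, expect_biasedBit]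
  simp [expect_map, expect_pure, expect_const]

theorem expect_noisyBit {F : Type*} [NormedAddCommGroup F] [NormedSpace ℝ F] (k : ℕ) (x : Bool)
    (f : Bool → F) : expect (noisyBit k x) f =
      (1 - 1 / (2 * (k : ℝ) ^ 2)) • f x + (1 / (2 * (k : ℝ) ^ 2)) • f (!x) := by
  have hu : expect (PMF.uniformOfFintype Bool) f = (1 / 2 : ℝ) • f x + (1 / 2 : ℝ) • f (!x) := by
    rw [expect_eq_sum, Fintype.sum_bool]
    cases x
    · simp [add_comm]
    · simp
  rw [noisyBit, expect_bind, expect_biasedBit]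
  simp only [if_true, Bool.false_eq_true, if_false, hu, expect_pure]
  module

/-- The law of all the noise symbols for one hyperedge. -/
noncomputable def noiseFamily (k M : ℕ) : PMF (Fin k → Fin M → Option Bool) :=
  piPMF fun _ => piPMF fun _ => noiseLaw k

/-- The noise symbols have a law independent of the bits, so they can be frozen before the strings
are exchanged. -/
theorem piPMF_noisyBit {M : ℕ} (x : Fin k → Fin M → Bool) :
    (piPMF fun p => piPMF fun j => noisyBit k (x p j)) =
      (noiseFamily k M).map fun ρ p j => (ρ p j).getD (x p j) := by
  simp only [noisyBit_eq_map, piPMF_map, noiseFamily]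

end

/-! ### The law of one hyperedge and the agreement as an average over hyperedges -/

section

variable {k M N : ℕ}

/-- The law of the independent strings `x n`, each distributed as `𝒟_b`. -/
noncomputable def stringsLaw (N : ℕ) (hk : 12 ^ 6 ≤ k) (b : Bool) : PMF (Fin N → Fin k → Bool) :=
  piPMF fun _ => testDist hk b

/-- The law of the noisy blocks of one hyperedge with projections `π`, given the strings `x`. -/
noncomputable def blocksLaw (π : Fin k → Fin M → Fin N) (x : Fin N → Fin k → Bool) :
    PMF (Fin k → Fin M → Bool) :=
  piPMF fun p => piPMF fun j => noisyBit k (x (π p j) p)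

/-- The expectation of a function of the noisy blocks of one hyperedge, for the label `b`. -/
noncomputable def blockExpect (hk : 12 ^ 6 ≤ k) (π : Fin k → Fin M → Fin N) (b : Bool)
    (f : (Fin k → Fin M → Bool) → ℝ) : ℝ :=
  expect (stringsLaw N hk b) fun x => expect (blocksLaw π x) f

theorem blocksLaw_eq_map (π : Fin k → Fin M → Fin N) (x : Fin N → Fin k → Bool) :
    blocksLaw π x = (noiseFamily k M).map fun ρ p j => (ρ p j).getD (x (π p j) p) :=
  piPMF_noisyBit fun p j => x (π p j) p

section BlockExpect

variable (hk : 12 ^ 6 ≤ k) (π : Fin k → Fin M → Fin N) (b : Bool)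

theorem blockExpect_mono {f g : (Fin k → Fin M → Bool) → ℝ} (h : ∀ z, f z ≤ g z) :
    blockExpect hk π b f ≤ blockExpect hk π b g :=
  expect_mono _ fun _ => expect_mono _ h

theorem blockExpect_add (f g : (Fin k → Fin M → Bool) → ℝ) :
    blockExpect hk π b (fun z => f z + g z) = blockExpect hk π b f + blockExpect hk π b g := by
  simp only [blockExpect, expect_add]

theorem blockExpect_le {f : (Fin k → Fin M → Bool) → ℝ} {c : ℝ} (h : ∀ z, f z ≤ c) :
    blockExpect hk π b f ≤ c := expect_le _ fun _ => expect_le _ h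

theorem blockExpect_nonneg {f : (Fin k → Fin M → Bool) → ℝ} (h : ∀ z, 0 ≤ f z) :
    0 ≤ blockExpect hk π b f := expect_nonneg _ fun _ => expect_nonneg _ h

theorem blockExpect_le_of_blocksLaw {f : (Fin k → Fin M → Bool) → ℝ} {c : ℝ}
    (h : ∀ x, expect (blocksLaw π x) f ≤ c) : blockExpect hk π b f ≤ c := expect_le _ h

theorem blockExpect_eq (f : (Fin k → Fin M → Bool) → ℝ) :
    blockExpect hk π b f = expect (stringsLaw N hk b) fun x => expect (noiseFamily k M)
      fun ρ => f fun p j => (ρ p j).getD (x (π p j) p) := by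
  simp only [blockExpect, blocksLaw_eq_map, expect_map]

end BlockExpect

/-- The indicator of `h z = b`. -/
def agreeInd (h : Bool) (b : Bool) : ℝ := if h = b then 1 else 0

theorem agreeInd_true (h : Bool) : agreeInd h true = bit h := rfl

theorem agreeInd_false (h : Bool) : agreeInd h false = 1 - bit h := by cases h <;> simp [agreeInd]

namespace KLabelCover

variable {V E : Type*} (L : KLabelCover k M N V E)

/-- The example that has the blocks `z` at the vertices of `e` and zeros elsewhere. -/
noncomputable def extendBlocks (e : E) (z : Fin k → Fin M → Bool) : V × Fin M → Bool :=
  fun c => Function.extend (L.vert e) z (fun _ _ => false) c.1 c.2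

theorem agreement_exampleDist [Finite V] [Fintype E] (hk : 12 ^ 6 ≤ k)
    (h : (V × Fin M → Bool) → Bool) :
    agreement (L.exampleDist hk) h = (∑ e, (1 / 2 : ℝ) *
      (blockExpect hk (L.proj e) true (fun z => agreeInd (h (L.extendBlocks e z)) true) +
        blockExpect hk (L.proj e) false (fun z => agreeInd (h (L.extendBlocks e z)) false))) /
      Fintype.card E := by
  classical
  have := L.nonempty_edges
  have hi : ∀ y b, {z : (V × Fin M → Bool) × Bool | h z.1 = z.2}.indicator (fun _ => (1 : ℝ))
      (y, b) = agreeInd (h y) b := by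
    intro y b
    by_cases hyb : h y = b <;> simp [agreeInd, hyb]
  rw [agreement, toOuterMeasure_toReal, exampleDist, expect_bind, expect_uniformOfFintype]
  congr 1
  refine Finset.sum_congr rfl fun e _ => ?_
  rw [expect_bind, expect_uniformOfFintype, Fintype.sum_bool, Fintype.card_bool]
  simp only [expect_bind, expect_pure, hi]
  rw [div_eq_inv_mul]
  norm_num
  rfl

theorem sum_extendBlocks [Fintype V] (e : E) (z : Fin k → Fin M → Bool) (w : V × Fin M → ℝ) :
    ∑ c, w c * bit (L.extendBlocks e z c) = ∑ p, ∑ j, w (L.vert e p, j) * bit (z p j) := by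
  rw [Fintype.sum_prod_type]
  refine (Fintype.sum_of_injective (L.vert e) (L.vert_injective e) _ _ ?_ ?_).symm
  · intro v hv
    refine Finset.sum_eq_zero fun j _ => ?_
    rw [extendBlocks, Function.extend_apply' _ _ _ (by simpa using hv)]
    simp
  · intro p
    simp only [extendBlocks, (L.vert_injective e).extend_apply]

end KLabelCover

/-! ### Completeness -/

theorem one_sub_le_expect_testDist (hk : 12 ^ 6 ≤ k) (b : Bool) :
    1 - 2 * eps k ≤ expect (testDist hk b) fun x => agreeInd (decide (∃ p, x p = true)) b := by
  have h0 := eps_nonneg k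
  have h1 := eps_le hk
  have hind : ∀ (c d : Bool), 0 ≤ agreeInd c d := fun c d => by unfold agreeInd; split_ifs <;> simp
  obtain ⟨g0, g1⟩ := gap_bounds hk
  cases b with
  | true =>
    simp only [testDist, if_true, expect_distOne]
    have hkpos : (0 : ℝ) < k := by
      have : 0 < k := lt_of_lt_of_le (by norm_num) hk
      exact_mod_cast this
    have h2 : (∑ p : Fin k, agreeInd (decide (∃ q, decide (q = p) = true)) true) / (k : ℝ) = 1 := by
      simp [agreeInd, hkpos.ne']
    rw [h2]
    have h3 : 0 ≤ ∑ i, eps k / 4 * expect (iidBits hk i)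
        fun x => agreeInd (decide (∃ p, x p = true)) true :=
      Finset.sum_nonneg fun i _ => mul_nonneg (by linarith) (expect_nonneg _ fun x => hind _ _)
    linarith
  | false =>
    simp only [testDist, Bool.false_eq_true, if_false, expect_distZero]
    have h2 : agreeInd (decide (∃ p : Fin k, False)) false = 1 := by simp [agreeInd]
    rw [h2]
    have h3 : 0 ≤ ∑ i, negWeight k i * expect (iidBits hk i)
        fun x => agreeInd (decide (∃ p, x p = true)) false :=
      Finset.sum_nonneg fun i _ => mul_nonneg (negWeight_nonneg hk i)
        (expect_nonneg _ fun x => hind _ _)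
    -- The coefficients `c_i` add up to 25/12, and the gap they multiply is at most `ε / 12`.
    have h4 : ∑ i, negWeight k i ≤ 2 * eps k := by
      simp only [negWeight, Fin.sum_univ_four]
      simp
      linarith
    linarith

theorem completeness (k : ℕ) (hk : 12 ^ 6 ≤ k) (M N : ℕ) {V E : Type*} [Fintype V] [Fintype E]
    (L : KLabelCover k M N V E) (hL : L.StronglySatisfiable) :
    ∃ h : (V × Fin M → Bool) → Bool, IsDisjunction h ∧
      1 - 3 / Real.sqrt k ≤ agreement (L.exampleDist hk) h := by
  classical
  obtain ⟨Λ, hΛ⟩ := hL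
  have hk0 : 0 < k := lt_of_lt_of_le (by norm_num) hk
  have hkpos : (0 : ℝ) < k := by exact_mod_cast hk0
  refine ⟨fun y => decide (∃ v, y (v, Λ v) = true),
    ⟨Finset.univ.image fun v => (v, Λ v), fun _ => true, fun y => by simp⟩, ?_⟩
  have hedge : ∀ (e : E) (b : Bool), 1 - 3 / Real.sqrt k ≤ blockExpect hk (L.proj e) b fun z =>
      agreeInd (decide (∃ v, L.extendBlocks e z (v, Λ v) = true)) b := by
    intro e b
    set n₀ : Fin N := L.proj e ⟨0, hk0⟩ (Λ (L.vert e ⟨0, hk0⟩)) with hn₀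
    have hn : ∀ p, L.proj e p (Λ (L.vert e p)) = n₀ := fun p => hΛ e p _
    rw [blockExpect_eq]
    have hpt : ∀ (x : Fin N → Fin k → Bool) (ρ : Fin k → Fin M → Option Bool),
        agreeInd (decide (∃ p, x n₀ p = true)) b -
          ∑ p, (if (ρ p (Λ (L.vert e p))).isSome then (1 : ℝ) else 0) ≤
        agreeInd (decide (∃ v, L.extendBlocks e
          (fun p j => (ρ p j).getD (x (L.proj e p j) p)) (v, Λ v) = true)) b := by
      intro x ρ
      -- If one of the `k` relevant coordinates is noisy, the subtracted sum is at least 1 and the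
      -- bound is trivial; otherwise the disjunction is exactly the OR of `x n₀`.
      by_cases hρ : ∃ p, (ρ p (Λ (L.vert e p))).isSome
      · obtain ⟨p, hp⟩ := hρ
        have h1 : (1 : ℝ) ≤ ∑ p, (if (ρ p (Λ (L.vert e p))).isSome then (1 : ℝ) else 0) := by
          refine le_trans (by simp [hp]) (Finset.single_le_sum
            (f := fun p => if (ρ p (Λ (L.vert e p))).isSome then (1 : ℝ) else 0)
            (fun q _ => by positivity) (Finset.mem_univ p))
        have h2 : ∀ c, 0 ≤ agreeInd c b ∧ agreeInd c b ≤ 1 := fun c => by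
          unfold agreeInd; split_ifs <;> simp
        linarith [(h2 (decide (∃ p, x n₀ p = true))).2, (h2 (decide (∃ v, L.extendBlocks e
          (fun p j => (ρ p j).getD (x (L.proj e p j) p)) (v, Λ v) = true))).1]
      · push Not at hρ
        have h1 : ∀ p, ρ p (Λ (L.vert e p)) = none := fun p => by simpa using hρ p
        have h2 : (∃ v, L.extendBlocks e
            (fun p j => (ρ p j).getD (x (L.proj e p j) p)) (v, Λ v) = true) ↔
            ∃ p, x n₀ p = true := by
          constructor
          · rintro ⟨v, hv⟩
            by_cases hve : ∃ p, L.vert e p = v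
            · obtain ⟨p, rfl⟩ := hve
              rw [KLabelCover.extendBlocks, (L.vert_injective e).extend_apply, h1, hn] at hv
              exact ⟨p, hv⟩
            · rw [KLabelCover.extendBlocks, Function.extend_apply' _ _ _ hve] at hv
              simp at hv
          · rintro ⟨p, hp⟩
            refine ⟨L.vert e p, ?_⟩
            rw [KLabelCover.extendBlocks, (L.vert_injective e).extend_apply, h1, hn]
            exact hp
        simp [h1, h2]
    have h3 : ∀ x : Fin N → Fin k → Bool, agreeInd (decide (∃ p, x n₀ p = true)) b - 1 / k ≤
        expect (noiseFamily k M) fun ρ => agreeInd (decide (∃ v, L.extendBlocks e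
          (fun p j => (ρ p j).getD (x (L.proj e p j) p)) (v, Λ v) = true)) b := by
      intro x
      refine le_trans (le_of_eq ?_) (expect_mono _ (hpt x))
      rw [expect_sub, expect_const, expect_sum]
      congr 1
      have h4 : ∀ p, expect (noiseFamily k M)
          (fun ρ => if (ρ p (Λ (L.vert e p))).isSome then (1 : ℝ) else 0) = 1 / (k : ℝ) ^ 2 := by
        intro p
        rw [noiseFamily, expect_piPMF_eval _ p
          (fun r : Fin M → Option Bool => if (r (Λ (L.vert e p))).isSome then (1 : ℝ) else 0),
          expect_piPMF_eval _ (Λ (L.vert e p))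
          (fun r : Option Bool => if r.isSome then (1 : ℝ) else 0), expect_noiseLaw_isSome]
      simp only [h4, Finset.sum_const, Finset.card_univ, Fintype.card_fin, nsmul_eq_mul]
      field_simp
    refine le_trans ?_ (expect_mono _ h3)
    rw [expect_sub, expect_const, stringsLaw,
      expect_piPMF_eval _ n₀ (fun r : Fin k → Bool => agreeInd (decide (∃ p, r p = true)) b)]
    have h5 := one_sub_le_expect_testDist hk b
    have h6 : 1 / (k : ℝ) ≤ 1 / Real.sqrt k := by
      refine one_div_le_one_div_of_le (Real.sqrt_pos.2 hkpos) ?_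
      rw [Real.sqrt_le_left hkpos.le]
      have : (1 : ℝ) ≤ k := by exact_mod_cast hk0
      nlinarith
    have h7 : 3 / Real.sqrt k = 2 * (1 / Real.sqrt k) + 1 / Real.sqrt k := by ring
    rw [eps] at h5
    linarith
  rw [L.agreement_exampleDist]
  have := L.nonempty_edges
  have hE : (0 : ℝ) < Fintype.card E := by exact_mod_cast Fintype.card_pos
  rw [le_div_iff₀ hE, mul_comm, ← nsmul_eq_mul, ← Finset.card_univ, ← Finset.sum_const]
  refine Finset.sum_le_sum fun e _ => ?_
  linarith [hedge e true, hedge e false]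

end

section

/-! ### A smooth step function -/

/-- The step is locally constant off `[0, 1]`, so compactness of that interval suffices. -/
theorem exists_bound_iteratedDeriv_smoothTransition (n : ℕ) (hn : n ≠ 0) :
    ∃ K : ℝ, ∀ x, |iteratedDeriv n Real.smoothTransition x| ≤ K := by
  have hc : Continuous (iteratedDeriv n Real.smoothTransition) :=
    (Real.smoothTransition.contDiff (n := n)).continuous_iteratedDeriv n le_rfl
  obtain ⟨K, hK⟩ := (isCompact_Icc (a := (0 : ℝ)) (b := 1)).exists_bound_of_continuousOn
    hc.continuousOn
  have hK0 : 0 ≤ K := (norm_nonneg _).trans (hK 0 (by simp))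
  refine ⟨K, fun x => ?_⟩
  have hout : ∀ c : ℝ, Real.smoothTransition =ᶠ[nhds x] (fun _ => c) →
      |iteratedDeriv n Real.smoothTransition x| ≤ K := by
    intro c h
    rw [h.iteratedDeriv_eq, iteratedDeriv_const, if_neg hn, abs_zero]
    exact hK0
  rcases lt_or_ge x 0 with h0 | h0
  · exact hout 0 (Filter.eventuallyEq_of_mem (Iio_mem_nhds h0) fun y hy =>
      Real.smoothTransition.zero_of_nonpos (le_of_lt hy))
  rcases lt_or_ge 1 x with h1 | h1
  · exact hout 1 (Filter.eventuallyEq_of_mem (Ioi_mem_nhds h1) fun y hy =>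
      Real.smoothTransition.one_of_one_le (le_of_lt hy))
  exact hK x ⟨h0, h1⟩

/-- A third order Taylor expansion with uniformly bounded remainder. -/
def HasTaylorBound (φ : ℝ → ℝ) (K : ℝ) : Prop :=
  ∃ D : Fin 4 → ℝ → ℝ, ∀ x y, |φ (x + y) - (D 0 x + D 1 x * y + D 2 x * y ^ 2 + D 3 x * y ^ 3)|
    ≤ K * y ^ 4

theorem exists_hasTaylorBound_smoothTransition :
    ∃ K : ℝ, 0 ≤ K ∧ HasTaylorBound Real.smoothTransition K := by
  obtain ⟨K, hK⟩ := exists_bound_iteratedDeriv_smoothTransition 4 (by norm_num)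
  have hK0 : 0 ≤ K := (abs_nonneg _).trans (hK 0)
  refine ⟨K, hK0, fun m x => iteratedDeriv m Real.smoothTransition x / (m : ℕ).factorial,
    fun x y => ?_⟩
  rcases eq_or_ne y 0 with rfl | hy
  · simp
  have hxy : x ≠ x + y := by simpa using hy
  have hsm : ContDiff ℝ (4 : ℕ) Real.smoothTransition := Real.smoothTransition.contDiff
  obtain ⟨x', -, h⟩ := taylor_mean_remainder_lagrange_iteratedDeriv (n := 3) hxy
    (hsm.of_le (by norm_num)).contDiffOn
  have hT : taylorWithinEval Real.smoothTransition 3 (Set.uIcc x (x + y)) x (x + y) =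
      iteratedDeriv 0 Real.smoothTransition x / (0 : ℕ).factorial +
      iteratedDeriv 1 Real.smoothTransition x / (1 : ℕ).factorial * y +
      iteratedDeriv 2 Real.smoothTransition x / (2 : ℕ).factorial * y ^ 2 +
      iteratedDeriv 3 Real.smoothTransition x / (3 : ℕ).factorial * y ^ 3 := by
    have hd : ∀ m : ℕ, m ≤ 4 → iteratedDerivWithin m Real.smoothTransition (Set.uIcc x (x + y)) x =
        iteratedDeriv m Real.smoothTransition x := fun m hm =>
      iteratedDerivWithin_eq_iteratedDeriv (uniqueDiffOn_uIcc hxy)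
        (hsm.contDiffAt.of_le (by exact_mod_cast hm)) Set.left_mem_uIcc
    rw [taylor_within_apply]
    simp only [Finset.sum_range_succ, Finset.sum_range_zero, smul_eq_mul, add_sub_cancel_left]
    rw [hd 0 (by norm_num), hd 1 (by norm_num), hd 2 (by norm_num), hd 3 (by norm_num)]
    simp only [Nat.factorial]
    push_cast
    ring
  rw [hT] at h
  simp only [Fin.isValue, Fin.val_zero, Fin.val_one, Fin.val_two]
  change |_ - (_ + _ + _ + iteratedDeriv 3 Real.smoothTransition x / (3 : ℕ).factorial * y ^ 3)| ≤ _
  rw [h, add_sub_cancel_left, abs_div, abs_mul, abs_of_nonneg (show 0 ≤ y ^ (3 + 1) from Even.pow_nonneg (by decide) y),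
    div_le_iff₀ (by positivity)]
  have h1 := hK x'
  have h2 : 0 ≤ y ^ 4 := by positivity
  -- The factor `1 / 4!` is given away, so that `K` bounds the fourth derivative itself.
  have h3 : (1 : ℝ) ≤ |((3 + 1).factorial : ℝ)| := by norm_num [Nat.factorial]
  exact (mul_le_mul_of_nonneg_right h1 h2).trans (le_mul_of_one_le_right (by positivity) h3)

/-! ### Exchanging one string -/

variable {k M N : ℕ}

/-- Iterating this raises the degree by one linear form at a time, without expanding multiple sums.
-/
theorem expect_testDist_linear_mul (hk : 12 ^ 6 ≤ k) (b : Fin k → ℝ) (g : (Fin k → Bool) → ℝ)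
    (h : ∀ p, expect (testDist hk true) (fun x => bit (x p) * g x) =
      expect (testDist hk false) (fun x => bit (x p) * g x)) :
    expect (testDist hk true) (fun x => (∑ p, b p * bit (x p)) * g x) =
      expect (testDist hk false) (fun x => (∑ p, b p * bit (x p)) * g x) := by
  simp only [Finset.sum_mul, expect_sum, mul_assoc, expect_mul_left, h]

/-- The worst term is a cube of the linear form times one more bit, of degree 4. This is where the
fourth moment is needed. -/
theorem expect_testDist_cubic (hk : 12 ^ 6 ≤ k) (b : Fin k → ℝ) (q : Fin k) (u v : Fin 4 → ℝ) :
    expect (testDist hk true) (fun x =>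
      (u 0 + v 0 * bit (x q)) + (u 1 + v 1 * bit (x q)) * (∑ p, b p * bit (x p)) +
      (u 2 + v 2 * bit (x q)) * (∑ p, b p * bit (x p)) ^ 2 +
      (u 3 + v 3 * bit (x q)) * (∑ p, b p * bit (x p)) ^ 3) =
    expect (testDist hk false) (fun x =>
      (u 0 + v 0 * bit (x q)) + (u 1 + v 1 * bit (x q)) * (∑ p, b p * bit (x p)) +
      (u 2 + v 2 * bit (x q)) * (∑ p, b p * bit (x p)) ^ 2 +
      (u 3 + v 3 * bit (x q)) * (∑ p, b p * bit (x p)) ^ 3) := by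
  have sq : ∀ c : Bool, ∀ r : ℝ, bit c * (bit c * r) = bit c * r := fun c r => by
    rw [← mul_assoc, bit_mul_self]
  have m4 : ∀ p₁ p₂ p₃ p₄ : Fin k, expect (testDist hk true)
      (fun x => bit (x p₁) * (bit (x p₂) * (bit (x p₃) * bit (x p₄)))) =
      expect (testDist hk false)
      (fun x => bit (x p₁) * (bit (x p₂) * (bit (x p₃) * bit (x p₄)))) := fun p₁ p₂ p₃ p₄ => by
    simpa only [mul_assoc] using expect_testDist_monomial hk p₁ p₂ p₃ p₄
  have m3 : ∀ p₁ p₂ p₃ : Fin k, expect (testDist hk true)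
      (fun x => bit (x p₁) * (bit (x p₂) * bit (x p₃))) =
      expect (testDist hk false)
      (fun x => bit (x p₁) * (bit (x p₂) * bit (x p₃))) := fun p₁ p₂ p₃ => by
    simpa only [sq] using m4 p₁ p₁ p₂ p₃
  have m2 : ∀ p₁ p₂ : Fin k, expect (testDist hk true) (fun x => bit (x p₁) * bit (x p₂)) =
      expect (testDist hk false) (fun x => bit (x p₁) * bit (x p₂)) := fun p₁ p₂ => by
    simpa only [sq] using m3 p₁ p₁ p₂
  have m1 : ∀ p₁ : Fin k, expect (testDist hk true) (fun x => bit (x p₁)) =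
      expect (testDist hk false) (fun x => bit (x p₁)) := fun p₁ => by
    simpa only [bit_mul_self] using m2 p₁ p₁
  have lin := expect_testDist_linear_mul hk b
  have l1 : ∀ g : (Fin k → Bool) → ℝ, (∀ p₁, expect (testDist hk true) (fun x => bit (x p₁) * g x) =
      expect (testDist hk false) (fun x => bit (x p₁) * g x)) → _ := fun g hg => lin g hg
  have l2 : ∀ g : (Fin k → Bool) → ℝ, (∀ p₁ p₂, expect (testDist hk true)
      (fun x => bit (x p₁) * (bit (x p₂) * g x)) =
      expect (testDist hk false) (fun x => bit (x p₁) * (bit (x p₂) * g x))) → _ :=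
    fun g hg => lin (fun x => (∑ p, b p * bit (x p)) * g x) fun p => by
      simp only [mul_left_comm (bit _) (Finset.sum _ _)]
      exact lin _ fun p' => hg p' p
  have l3 : ∀ g : (Fin k → Bool) → ℝ, (∀ p₁ p₂ p₃, expect (testDist hk true)
      (fun x => bit (x p₁) * (bit (x p₂) * (bit (x p₃) * g x))) =
      expect (testDist hk false) (fun x => bit (x p₁) * (bit (x p₂) * (bit (x p₃) * g x)))) → _ :=
    fun g hg => l2 (fun x => (∑ p, b p * bit (x p)) * g x) fun p₁ p₂ => by
      simp only [mul_left_comm (bit _) (Finset.sum _ _)]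
      exact lin _ fun p' => hg p' p₁ p₂
  have e1 := l1 (fun _ => 1) (by simpa using m1)
  have e1' := l1 (fun x => bit (x q)) (fun p₁ => m2 p₁ q)
  have e2 := l2 (fun _ => 1) (by simpa using m2)
  have e2' := l2 (fun x => bit (x q)) (fun p₁ p₂ => m3 p₁ p₂ q)
  have e3 := l3 (fun _ => 1) (by simpa using m3)
  have e3' := l3 (fun x => bit (x q)) (fun p₁ p₂ p₃ => m4 p₁ p₂ p₃ q)
  have expand : ∀ c : Bool, expect (testDist hk c) (fun x =>
      (u 0 + v 0 * bit (x q)) + (u 1 + v 1 * bit (x q)) * (∑ p, b p * bit (x p)) +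
      (u 2 + v 2 * bit (x q)) * (∑ p, b p * bit (x p)) ^ 2 +
      (u 3 + v 3 * bit (x q)) * (∑ p, b p * bit (x p)) ^ 3) =
      u 0 + v 0 * expect (testDist hk c) (fun x => bit (x q)) +
      u 1 * expect (testDist hk c) (fun x => (∑ p, b p * bit (x p)) * 1) +
      v 1 * expect (testDist hk c) (fun x => (∑ p, b p * bit (x p)) * bit (x q)) +
      u 2 * expect (testDist hk c) (fun x => (∑ p, b p * bit (x p)) *
        ((∑ p, b p * bit (x p)) * 1)) +
      v 2 * expect (testDist hk c) (fun x => (∑ p, b p * bit (x p)) *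
        ((∑ p, b p * bit (x p)) * bit (x q))) +
      u 3 * expect (testDist hk c) (fun x => (∑ p, b p * bit (x p)) *
        ((∑ p, b p * bit (x p)) * ((∑ p, b p * bit (x p)) * 1))) +
      v 3 * expect (testDist hk c) (fun x => (∑ p, b p * bit (x p)) *
        ((∑ p, b p * bit (x p)) * ((∑ p, b p * bit (x p)) * bit (x q)))) := by
    intro c
    simp only [← expect_mul_left]
    rw [← expect_const (testDist hk c) (u 0)]
    simp only [← expect_add]
    congr 1
    ext x
    rw [expect_const]
    ring
  rw [expand, expand, e1, e1', e2, e2', e3, e3', m1]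

/-- The bound does not involve `a`: the expansion is made around `c + a x_q`, and its coefficients,
as functions of the bit `x_q`, interpolate affinely between `D i c` and `D i (c + a)`. Each label
then contributes one remainder `K B⁴`. -/
theorem abs_expect_testDist_sub_le (hk : 12 ^ 6 ≤ k) {φ : ℝ → ℝ} {K : ℝ} (hK : 0 ≤ K)
    (hφ : HasTaylorBound φ K) (c a : ℝ) (q : Fin k) (b : Fin k → ℝ) {B : ℝ}
    (hB : ∑ p, |b p| ≤ B) :
    |expect (testDist hk true) (fun x => φ (c + a * bit (x q) + ∑ p, b p * bit (x p))) -
      expect (testDist hk false) (fun x => φ (c + a * bit (x q) + ∑ p, b p * bit (x p)))| ≤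
      2 * K * B ^ 4 := by
  obtain ⟨D, hD⟩ := hφ
  have hcub := expect_testDist_cubic hk b q (fun i => D i c) (fun i => D i (c + a) - D i c)
  set T : (Fin k → Bool) → ℝ := fun x =>
      (D 0 c + (D 0 (c + a) - D 0 c) * bit (x q)) +
      (D 1 c + (D 1 (c + a) - D 1 c) * bit (x q)) * (∑ p, b p * bit (x p)) +
      (D 2 c + (D 2 (c + a) - D 2 c) * bit (x q)) * (∑ p, b p * bit (x p)) ^ 2 +
      (D 3 c + (D 3 (c + a) - D 3 c) * bit (x q)) * (∑ p, b p * bit (x p)) ^ 3 with hT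
  have hrem : ∀ x : Fin k → Bool,
      |φ (c + a * bit (x q) + ∑ p, b p * bit (x p)) - T x| ≤ K * B ^ 4 := by
    intro x
    have hl : |∑ p, b p * bit (x p)| ≤ B := by
      refine (Finset.abs_sum_le_sum_abs _ _).trans (le_trans ?_ hB)
      refine Finset.sum_le_sum fun p _ => ?_
      rw [abs_mul]
      exact mul_le_of_le_one_right (abs_nonneg _) (abs_bit_le_one _)
    have hl4 : (∑ p, b p * bit (x p)) ^ 4 ≤ B ^ 4 := by
      rw [← Even.pow_abs (by decide : Even 4)]
      gcongr
    have hTx : T x = D 0 (c + a * bit (x q)) + D 1 (c + a * bit (x q)) * (∑ p, b p * bit (x p)) +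
        D 2 (c + a * bit (x q)) * (∑ p, b p * bit (x p)) ^ 2 +
        D 3 (c + a * bit (x q)) * (∑ p, b p * bit (x p)) ^ 3 := by
      simp only [hT]
      cases x q <;> simp
    rw [hTx]
    exact (hD _ _).trans (mul_le_mul_of_nonneg_left hl4 hK)
  have h1 := abs_expect_le (testDist hk true) hrem
  have h2 := abs_expect_le (testDist hk false) hrem
  rw [expect_sub] at h1 h2
  rw [hcub] at h1
  rw [abs_le] at *
  constructor <;> linarith [h1.1, h1.2, h2.1, h2.2]

/-! ### Exchanging all strings -/

theorem expect_comm {α β : Type*} [Finite α] [Finite β] (p : PMF α) (q : PMF β) (f : α → β → ℝ) :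
    expect p (fun a => expect q (f a)) = expect q fun b => expect p fun a => f a b := by
  have := Fintype.ofFinite α
  have := Fintype.ofFinite β
  simp only [expect_eq_sum, smul_eq_mul, Finset.mul_sum]
  rw [Finset.sum_comm]
  exact Finset.sum_congr rfl fun b _ => Finset.sum_congr rfl fun a _ => by ring

open scoped Classical in
/-- The total weight that a block puts on the labels outside `H p` that project to `n`. -/
noncomputable def fiberWeight (π : Fin k → Fin M → Fin N) (H : Fin k → Finset (Fin M))
    (W : Fin k → Fin M → ℝ) (n : Fin N) (p : Fin k) : ℝ :=
  ∑ j ∈ (H p)ᶜ with π p j = n, |W p j|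

theorem abs_blockExpect_sub_le (hk : 12 ^ 6 ≤ k) {φ : ℝ → ℝ} {K : ℝ} (hK : 0 ≤ K)
    (hφ : HasTaylorBound φ K) (π : Fin k → Fin M → Fin N) (H : Fin k → Finset (Fin M))
    (hH : ∀ p q, ∀ i ∈ H p, ∀ j ∈ H q, π p i = π q j → p = q) (W : Fin k → Fin M → ℝ) (c₀ : ℝ) :
    |blockExpect hk π true (fun z => φ (c₀ + ∑ p, ∑ j, W p j * bit (z p j))) -
      blockExpect hk π false (fun z => φ (c₀ + ∑ p, ∑ j, W p j * bit (z p j)))| ≤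
      ∑ n, 2 * K * (∑ p, fiberWeight π H W n p) ^ 4 := by
  classical
  have hk0 : 0 < k := lt_of_lt_of_le (by norm_num) hk
  rw [blockExpect_eq, blockExpect_eq, expect_comm, expect_comm (stringsLaw N hk false),
    ← expect_sub]
  -- From here on the noise `ρ` is fixed, and only the strings are random.
  refine abs_expect_le _ fun ρ => ?_
  refine abs_expect_piPMF_sub_le _ _ _ _ fun n x => ?_
  set A : Fin k → ℝ := fun p => ∑ j with j ∈ H p ∧ π p j = n ∧ ρ p j = none, W p j with hA
  set b : Fin k → ℝ := fun p => ∑ j with j ∉ H p ∧ π p j = n ∧ ρ p j = none, W p j with hb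
  set c : ℝ := ∑ p, ∑ j with ¬(π p j = n ∧ ρ p j = none),
    W p j * bit ((ρ p j).getD (x (π p j) p)) with hc
  -- Non-colliding lists leave at most one vertex with heavy labels above `n`; if there is none, any
  -- index serves.
  obtain ⟨q, hq⟩ : ∃ q, ∀ p, p ≠ q → A p = 0 := by
    by_cases h : ∃ q, ∃ j ∈ H q, π q j = n
    · obtain ⟨q, j, hj, hjn⟩ := h
      refine ⟨q, fun p hp => Finset.sum_eq_zero fun i hi => ?_⟩
      obtain ⟨-, hi1, hi2, -⟩ := Finset.mem_filter.1 hi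
      exact absurd (hH p q i hi1 j hj (hi2.trans hjn.symm)) hp
    · push Not at h
      refine ⟨⟨0, hk0⟩, fun p _ => Finset.sum_eq_zero fun i hi => ?_⟩
      obtain ⟨-, hi1, hi2, -⟩ := Finset.mem_filter.1 hi
      exact absurd hi2 (h p i hi1)
  have hS : ∀ y : Fin k → Bool,
      c₀ + ∑ p, ∑ j, W p j * bit ((ρ p j).getD (Function.update x n y (π p j) p)) =
        (c₀ + c) + A q * bit (y q) + ∑ p, b p * bit (y p) := by
    intro y
    have hAq : A q * bit (y q) = ∑ p, A p * bit (y p) := by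
      rw [Finset.sum_eq_single_of_mem q (Finset.mem_univ q)]
      intro p _ hp
      rw [hq p hp, zero_mul]
    rw [hAq, hc, add_assoc, add_assoc, ← Finset.sum_add_distrib, ← Finset.sum_add_distrib]
    congr 1
    refine Finset.sum_congr rfl fun p _ => ?_
    rw [hA, hb, Finset.sum_mul, Finset.sum_mul]
    simp only [Finset.sum_filter]
    rw [← Finset.sum_add_distrib, ← Finset.sum_add_distrib]
    refine Finset.sum_congr rfl fun j _ => ?_
    by_cases h1 : π p j = n
    · subst h1
      by_cases h2 : ρ p j = none
      · by_cases h3 : j ∈ H p <;> simp [h2, h3]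
      · obtain ⟨d, hd⟩ := Option.ne_none_iff_exists'.1 h2
        simp [hd]
    · simp [h1]
  simp only [hS]
  refine abs_expect_testDist_sub_le hk hK hφ (c₀ + c) (A q) q b ?_
  refine Finset.sum_le_sum fun p _ => (Finset.abs_sum_le_sum_abs _ _).trans ?_
  refine Finset.sum_le_sum_of_subset_of_nonneg (fun j hj => ?_) fun _ _ _ => abs_nonneg _
  simp only [Finset.mem_filter, Finset.mem_compl] at hj ⊢
  exact ⟨hj.2.1, hj.2.2.1⟩

end

section

/-! ### A small ball estimate through characteristic functions -/

theorem integral_one_sub_mul_cos {x : ℝ} (hx : x ≠ 0) :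
    ∫ t in (0 : ℝ)..1, (1 - t) * Real.cos (t * x) = (1 - Real.cos x) / x ^ 2 := by
  have h : ∀ t ∈ Set.uIcc (0 : ℝ) 1, HasDerivAt
      (fun t => (1 - t) * Real.sin (t * x) / x - Real.cos (t * x) / x ^ 2)
      ((1 - t) * Real.cos (t * x)) t := by
    intro t _
    have h1 : HasDerivAt (fun t : ℝ => t * x) x t := by simpa using (hasDerivAt_id t).mul_const x
    have h2 : HasDerivAt (fun t : ℝ => 1 - t) (-1) t := by
      simpa using (hasDerivAt_id t).const_sub 1
    have h3 := ((h2.mul h1.sin).div_const x).sub (h1.cos.div_const (x ^ 2))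
    refine h3.congr_deriv ?_
    field_simp
    ring
  rw [intervalIntegral.integral_eq_sub_of_hasDerivAt h (by
    apply Continuous.intervalIntegrable; fun_prop)]
  simp
  ring

theorem two_mul_sq_le_one_sub_cos {x : ℝ} (hx : |x| ≤ Real.pi) :
    2 / Real.pi ^ 2 * x ^ 2 ≤ 1 - Real.cos x := by
  linarith [Real.cos_le_one_sub_mul_cos_sq hx]

theorem pi_sq_lt_ten : Real.pi ^ 2 < 10 := by
  have := Real.pi_lt_d2
  have := Real.pi_pos
  nlinarith

theorem sq_le_one_sub_cos {x : ℝ} (hx : |x| ≤ 1) : 1 / 5 * x ^ 2 ≤ 1 - Real.cos x := by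
  have hpi := Real.pi_gt_three
  have h := two_mul_sq_le_one_sub_cos (hx.trans (by linarith : (1 : ℝ) ≤ Real.pi))
  have h2 : (1 : ℝ) / 5 ≤ 2 / Real.pi ^ 2 := by
    rw [div_le_div_iff₀ (by norm_num) (by positivity)]
    linarith [pi_sq_lt_ten]
  exact (mul_le_mul_of_nonneg_right h2 (sq_nonneg x)).trans h

open scoped Classical in
-- The integral equals `(1 - cos x) / x²`, which is nonnegative everywhere and at least `1/5` for `0
-- < |x| ≤ 1`. This turns small-ball probabilities into characteristic functions.
theorem indicator_le_integral_one_sub_mul_cos (x : ℝ) :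
    (if |x| ≤ 1 then (1 : ℝ) else 0) ≤ 5 * ∫ t in (0 : ℝ)..1, (1 - t) * Real.cos (t * x) := by
  rcases eq_or_ne x 0 with rfl | hx
  · have : ∫ t in (0 : ℝ)..1, (1 - t) = 1 / 2 := by
      rw [intervalIntegral.integral_sub (by simp) (by simp)]
      simp
      norm_num
    simp [this]
    norm_num
  · rw [integral_one_sub_mul_cos hx]
    split_ifs with h
    · have := sq_le_one_sub_cos h
      rw [← mul_div_assoc, le_div_iff₀ (by positivity)]
      linarith
    · have := Real.cos_le_one x
      have : 0 ≤ (1 - Real.cos x) / x ^ 2 := div_nonneg (by linarith) (sq_nonneg x)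
      linarith

open scoped Classical in
theorem expect_abs_le_one_le {Ω : Type*} [Finite Ω] (p : PMF Ω) (X : Ω → ℝ) {G : ℝ → ℝ}
    (hG : Continuous G)
    (h : ∀ t : ℝ, ‖expect p (fun ω => Complex.exp (Complex.I * (t * X ω : ℝ)))‖ ≤ G t) :
    expect p (fun ω => if |X ω| ≤ 1 then (1 : ℝ) else 0) ≤ 5 * ∫ t in (0 : ℝ)..1, G t := by
  have := Fintype.ofFinite Ω
  refine (expect_mono p fun ω => indicator_le_integral_one_sub_mul_cos (X ω)).trans ?_
  rw [expect_mul_left]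
  refine mul_le_mul_of_nonneg_left ?_ (by norm_num)
  have hint : ∀ ω, IntervalIntegrable (fun t => (p ω).toReal * ((1 - t) * Real.cos (t * X ω)))
      MeasureTheory.volume 0 1 := fun ω => by
    apply Continuous.intervalIntegrable; fun_prop
  have h1 : expect p (fun ω => ∫ t in (0 : ℝ)..1, (1 - t) * Real.cos (t * X ω)) =
      ∫ t in (0 : ℝ)..1, (1 - t) * expect p (fun ω => Real.cos (t * X ω)) := by
    simp only [expect_eq_sum, smul_eq_mul, ← intervalIntegral.integral_const_mul]
    rw [← intervalIntegral.integral_finsetSum fun ω _ => hint ω]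
    simp only [Finset.mul_sum]
    congr 1
    ext t
    exact Finset.sum_congr rfl fun ω _ => by ring
  rw [h1]
  refine intervalIntegral.integral_mono_on (by norm_num) ?_ (hG.intervalIntegrable _ _) ?_
  · apply Continuous.intervalIntegrable
    simp only [expect_eq_sum]
    fun_prop
  · intro t ht
    have h2 : expect p (fun ω => Real.cos (t * X ω)) ≤ G t := by
      refine le_trans (le_trans (le_of_eq ?_) (Complex.re_le_norm _)) (h t)
      simp only [expect_eq_sum, Complex.re_sum, Complex.real_smul, Complex.re_ofReal_mul,
        smul_eq_mul]
      refine Finset.sum_congr rfl fun ω _ => ?_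
      rw [mul_comm Complex.I, Complex.exp_ofReal_mul_I_re]
    have h3 : 0 ≤ G t := (norm_nonneg _).trans (h t)
    nlinarith [ht.1, ht.2]

/-- The squared modulus is `1 - 2q(1 - q)(1 - cos a)`; then `1 + u ≤ exp u`. -/
theorem norm_add_mul_exp_le (q a : ℝ) :
    ‖((1 - q : ℝ) : ℂ) + (q : ℂ) * Complex.exp (Complex.I * (a : ℝ))‖ ≤
      Real.exp (-(q * (1 - q)) * (1 - Real.cos a)) := by
  rw [← abs_of_nonneg (norm_nonneg _), ← abs_of_nonneg (Real.exp_nonneg _), ← sq_le_sq,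
    ← Complex.normSq_eq_norm_sq, Complex.normSq_apply, mul_comm Complex.I, ← Real.exp_nat_mul]
  simp only [Complex.add_re, Complex.add_im, Complex.ofReal_re, Complex.ofReal_im,
    Complex.re_ofReal_mul, Complex.im_ofReal_mul, Complex.exp_ofReal_mul_I_re,
    Complex.exp_ofReal_mul_I_im]
  refine le_trans (le_of_eq ?_) (Real.add_one_le_exp _)
  have := Real.sin_sq_add_cos_sq a
  push_cast
  linear_combination q ^ 2 * this

theorem norm_expect_noisyBit_le {k : ℕ} (hk : 1 ≤ k) (x : Bool) (a : ℝ) :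
    ‖expect (noisyBit k x) (fun b => Complex.exp (Complex.I * (a * bit b : ℝ)))‖ ≤
      Real.exp (-(1 / (4 * (k : ℝ) ^ 2)) * (1 - Real.cos a)) := by
  have hk1 : (1 : ℝ) ≤ k := by exact_mod_cast hk
  set q : ℝ := 1 / (2 * (k : ℝ) ^ 2) with hq
  have hq0 : 0 ≤ q := by positivity
  have hq1 : q ≤ 1 / 2 := by
    rw [hq]
    exact one_div_le_one_div_of_le (by norm_num) (by nlinarith)
  have hqq : 1 / (4 * (k : ℝ) ^ 2) ≤ q * (1 - q) := by
    have : 1 / (4 * (k : ℝ) ^ 2) = q * (1 / 2) := by rw [hq]; field_simp; norm_num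
    rw [this]
    exact mul_le_mul_of_nonneg_left (by linarith) hq0
  have hcos : 0 ≤ 1 - Real.cos a := by linarith [Real.cos_le_one a]
  have hexp : Real.exp (-(q * (1 - q)) * (1 - Real.cos a)) ≤
      Real.exp (-(1 / (4 * (k : ℝ) ^ 2)) * (1 - Real.cos a)) :=
    Real.exp_le_exp.2 (mul_le_mul_of_nonneg_right (neg_le_neg hqq) hcos)
  rw [expect_noisyBit, ← hq]
  cases x
  · refine le_trans (le_of_eq ?_) ((norm_add_mul_exp_le q a).trans hexp)
    simp
  · have h := norm_add_mul_exp_le (1 - q) a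
    have e : (1 - q) * (1 - (1 - q)) = q * (1 - q) := by ring
    rw [e] at h
    refine le_trans (le_of_eq ?_) (h.trans hexp)
    simp [add_comm]

variable {k M N : ℕ}

/-- Given the strings, the coordinates are independent because of the noise, so the characteristic
function factors. The bound is uniform in the strings. -/
theorem norm_expect_blocksLaw_le (hk : 1 ≤ k) (π : Fin k → Fin M → Fin N)
    (x : Fin N → Fin k → Bool) (W : Fin k → Fin M → ℝ) (θ t : ℝ) :
    ‖expect (blocksLaw π x) (fun z => Complex.exp (Complex.I *
      (t * (∑ p, ∑ j, W p j * bit (z p j) - θ) : ℝ)))‖ ≤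
      Real.exp (-(1 / (4 * (k : ℝ) ^ 2)) * ∑ p, ∑ j, (1 - Real.cos (t * W p j))) := by
  classical
  have hsplit : ∀ z : Fin k → Fin M → Bool, Complex.exp (Complex.I *
      (t * (∑ p, ∑ j, W p j * bit (z p j) - θ) : ℝ)) =
      Complex.exp (Complex.I * (-(t * θ) : ℝ)) *
        ∏ p, ∏ j, Complex.exp (Complex.I * (t * W p j * bit (z p j) : ℝ)) := by
    intro z
    simp only [← Complex.exp_sum, ← Complex.exp_add, ← Finset.mul_sum]
    congr 1
    push_cast
    simp only [mul_sub, Finset.mul_sum, mul_assoc]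
    ring
  have hmul : expect (blocksLaw π x) (fun z => Complex.exp (Complex.I *
      (t * (∑ p, ∑ j, W p j * bit (z p j) - θ) : ℝ))) =
      Complex.exp (Complex.I * (-(t * θ) : ℝ)) *
        ∏ p, ∏ j, expect (noisyBit k (x (π p j) p))
          (fun b => Complex.exp (Complex.I * (t * W p j * bit b : ℝ))) := by
    simp only [hsplit]
    have h1 := expect_piPMF_prod (fun p => piPMF fun j => noisyBit k (x (π p j) p))
      fun p (r : Fin M → Bool) => ∏ j, Complex.exp (Complex.I * (t * W p j * bit (r j) : ℝ))
    have h2 := fun p => expect_piPMF_prod (fun j => noisyBit k (x (π p j) p))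
      fun j b => Complex.exp (Complex.I * (t * W p j * bit b : ℝ))
    simp only [h2] at h1
    rw [← h1, blocksLaw, expect_eq_sum, expect_eq_sum, Finset.mul_sum]
    exact Finset.sum_congr rfl fun z _ => by rw [mul_smul_comm]
  rw [hmul, norm_mul, mul_comm Complex.I, Complex.norm_exp_ofReal_mul_I, one_mul, norm_prod]
  simp only [norm_prod, Finset.mul_sum, Real.exp_sum]
  exact Finset.prod_le_prod (fun p _ => Finset.prod_nonneg fun j _ => norm_nonneg _) fun p _ =>
    Finset.prod_le_prod (fun j _ => norm_nonneg _) fun j _ => norm_expect_noisyBit_le hk _ _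

open scoped Classical in
-- Every coordinate contributes decay, so those outside a convenient set `A` may be dropped.
theorem blockExpect_abs_le_one_le (hk : 12 ^ 6 ≤ k) (π : Fin k → Fin M → Fin N) (b : Bool)
    (W : Fin k → Fin M → ℝ) (θ : ℝ) (A : Finset (Fin k × Fin M)) :
    blockExpect hk π b
      (fun z => if |∑ p, ∑ j, W p j * bit (z p j) - θ| ≤ 1 then (1 : ℝ) else 0) ≤
      5 * ∫ t in (0 : ℝ)..1,
        Real.exp (-(1 / (4 * (k : ℝ) ^ 2)) * ∑ c ∈ A, (1 - Real.cos (t * W c.1 c.2))) := by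
  refine blockExpect_le_of_blocksLaw hk π b fun x => ?_
  have hG : Continuous fun t : ℝ =>
      Real.exp (-(1 / (4 * (k : ℝ) ^ 2)) * ∑ c ∈ A, (1 - Real.cos (t * W c.1 c.2))) := by fun_prop
  refine expect_abs_le_one_le (blocksLaw π x) (fun z => ∑ p, ∑ j, W p j * bit (z p j) - θ) hG
    fun t => ?_
  refine (norm_expect_blocksLaw_le (le_trans (by norm_num) hk) π x W θ t).trans ?_
  refine Real.exp_le_exp.2 (mul_le_mul_of_nonpos_left ?_ (neg_nonpos.2 (by positivity)))
  rw [← Fintype.sum_prod_type' (f := fun p j => 1 - Real.cos (t * W p j))]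
  exact Finset.sum_le_sum_of_subset_of_nonneg (Finset.subset_univ _) fun c _ _ => by
    linarith [Real.cos_le_one (t * W c.1 c.2)]

/-! ### Bounds for the integrals -/

theorem intervalIntegral_exp_neg_mul_sq_le {b : ℝ} (hb : 0 < b) {u v : ℝ} (huv : u ≤ v) :
    ∫ t in u..v, Real.exp (-b * t ^ 2) ≤ Real.sqrt (Real.pi / b) := by
  rw [intervalIntegral.integral_of_le huv, ← integral_gaussian]
  exact MeasureTheory.setIntegral_le_integral (integrable_exp_neg_mul_sq hb)
    (Filter.Eventually.of_forall fun t => (Real.exp_pos _).le)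

/-- For small weights and `t ≤ 1` the arguments of the cosines stay in `[-1, 1]`, where `1 - cos` is
at least quadratic; the rest is a Gaussian integral. -/
theorem integral_exp_le_of_abs_le_one {ι : Type*} (hk : 1 ≤ k) (A : Finset ι) (a : ι → ℝ)
    (ha : ∀ c ∈ A, |a c| ≤ 1) (hV : 0 < ∑ c ∈ A, a c ^ 2) :
    ∫ t in (0 : ℝ)..1, Real.exp (-(1 / (4 * (k : ℝ) ^ 2)) * ∑ c ∈ A, (1 - Real.cos (t * a c))) ≤
      8 * k / Real.sqrt (∑ c ∈ A, a c ^ 2) := by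
  have hk1 : (1 : ℝ) ≤ k := by exact_mod_cast hk
  set V := ∑ c ∈ A, a c ^ 2 with hVdef
  set b : ℝ := V / (20 * (k : ℝ) ^ 2) with hb
  have hb0 : 0 < b := by positivity
  have h1 : ∫ t in (0 : ℝ)..1,
      Real.exp (-(1 / (4 * (k : ℝ) ^ 2)) * ∑ c ∈ A, (1 - Real.cos (t * a c))) ≤
      ∫ t in (0 : ℝ)..1, Real.exp (-b * t ^ 2) := by
    refine intervalIntegral.integral_mono_on (by norm_num)
      (by apply Continuous.intervalIntegrable; fun_prop)
      (by apply Continuous.intervalIntegrable; fun_prop) fun t ht => Real.exp_le_exp.2 ?_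
    have h2 : 1 / 5 * t ^ 2 * V ≤ ∑ c ∈ A, (1 - Real.cos (t * a c)) := by
      rw [hVdef, Finset.mul_sum]
      refine Finset.sum_le_sum fun c hc => ?_
      have h3 : |t * a c| ≤ 1 := by
        rw [abs_mul, abs_of_nonneg ht.1]
        exact mul_le_one₀ ht.2 (abs_nonneg _) (ha c hc)
      have := sq_le_one_sub_cos h3
      rw [mul_pow] at this
      linarith
    have h4 : b * t ^ 2 = 1 / (4 * (k : ℝ) ^ 2) * (1 / 5 * t ^ 2 * V) := by
      rw [hb]; field_simp; ring
    rw [neg_mul, neg_mul, h4]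
    exact neg_le_neg (mul_le_mul_of_nonneg_left h2 (by positivity))
  refine h1.trans ((intervalIntegral_exp_neg_mul_sq_le hb0 (by norm_num)).trans ?_)
  rw [Real.sqrt_le_left (by positivity), div_pow, Real.sq_sqrt hV.le, hb, div_div_eq_mul_div]
  refine div_le_div_of_nonneg_right ?_ hV.le
  have := Real.pi_lt_d2
  nlinarith [sq_nonneg (k : ℝ)]

/-- Large `a` makes the cosine wrap around. After substituting `u = t|a|`, the range is covered by
`⌈|a| / 2π⌉` periods, each bounded by a Gaussian integral, and dividing by `|a|` leaves at most `1 +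
L`. -/
theorem integral_exp_cos_le {K : ℝ} (hK : 0 < K) {L a : ℝ} (hL : 0 < L) (ha : 1 / L ≤ |a|) :
    ∫ t in (0 : ℝ)..1, Real.exp (-K * (1 - Real.cos (t * a))) ≤
      (1 + L) * Real.sqrt (Real.pi ^ 3 / (2 * K)) := by
  have hpi := Real.pi_pos
  have hpi3 := Real.pi_gt_three
  have ha0 : 0 < |a| := lt_of_lt_of_le (by positivity) ha
  set f : ℝ → ℝ := fun u => Real.exp (-K * (1 - Real.cos u)) with hf
  have hfc : Continuous f := by fun_prop
  have hf0 : ∀ u, 0 ≤ f u := fun u => (Real.exp_pos _).le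
  have hfp : Function.Periodic f (2 * Real.pi) := fun u => by simp only [hf, Real.cos_add_two_pi]
  have hint : ∀ u v, IntervalIntegrable f MeasureTheory.volume u v :=
    fun u v => hfc.intervalIntegrable u v
  have h1 : ∫ t in (0 : ℝ)..1, Real.exp (-K * (1 - Real.cos (t * a))) =
      |a|⁻¹ * ∫ u in (0 : ℝ)..|a|, f u := by
    have := intervalIntegral.integral_comp_mul_right f ha0.ne' (a := 0) (b := 1)
    rw [zero_mul, one_mul, smul_eq_mul] at this
    rw [← this]
    congr 1
    ext t
    simp only [hf]
    rw [← Real.cos_abs (t * a), ← Real.cos_abs (t * |a|), abs_mul, abs_mul, abs_abs]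
  set n : ℕ := ⌈|a| / (2 * Real.pi)⌉₊ with hn
  have hn1 : |a| ≤ n * (2 * Real.pi) := by
    rw [← div_le_iff₀ (by positivity)]
    exact Nat.le_ceil _
  have hn2 : (n : ℝ) ≤ |a| / (2 * Real.pi) + 1 := (Nat.ceil_lt_add_one (by positivity)).le
  have h2 : ∫ u in (0 : ℝ)..|a|, f u ≤ n * ∫ u in (-Real.pi)..Real.pi, f u := by
    have h3 := hfp.intervalIntegral_add_zsmul_eq n 0 hint
    have h4 := hfp.intervalIntegral_add_eq 0 (-Real.pi)
    have e : -Real.pi + 2 * Real.pi = Real.pi := by ring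
    rw [e] at h4
    rw [h4] at h3
    simp only [zero_add, zsmul_eq_mul, Int.cast_natCast] at h3
    rw [← h3]
    exact intervalIntegral.integral_mono_interval le_rfl ha0.le hn1
      (Filter.Eventually.of_forall hf0) (hint _ _)
  have h5 : ∫ u in (-Real.pi)..Real.pi, f u ≤ Real.sqrt (Real.pi ^ 3 / (2 * K)) := by
    have h6 : ∫ u in (-Real.pi)..Real.pi, f u ≤
        ∫ u in (-Real.pi)..Real.pi, Real.exp (-(2 * K / Real.pi ^ 2) * u ^ 2) := by
      refine intervalIntegral.integral_mono_on (by linarith) (hint _ _)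
        (by apply Continuous.intervalIntegrable; fun_prop) fun u hu => Real.exp_le_exp.2 ?_
      have h7 := two_mul_sq_le_one_sub_cos (abs_le.2 hu)
      have h8 : 2 * K / Real.pi ^ 2 * u ^ 2 = K * (2 / Real.pi ^ 2 * u ^ 2) := by ring
      rw [neg_mul, neg_mul, h8]
      exact neg_le_neg (mul_le_mul_of_nonneg_left h7 hK.le)
    refine h6.trans ((intervalIntegral_exp_neg_mul_sq_le (by positivity) (by linarith)).trans
      (le_of_eq ?_))
    congr 1
    field_simp
  have h9 : |a|⁻¹ * n ≤ 1 + L := by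
    have h10 : |a|⁻¹ ≤ L := by
      rw [inv_le_comm₀ ha0 hL, ← one_div]
      exact ha
    have h11 : |a|⁻¹ * (|a| / (2 * Real.pi) + 1) = 1 / (2 * Real.pi) + |a|⁻¹ := by
      field_simp
    have h12 : 1 / (2 * Real.pi) ≤ 1 := by
      rw [div_le_one (by positivity)]
      linarith
    calc |a|⁻¹ * n ≤ |a|⁻¹ * (|a| / (2 * Real.pi) + 1) := by gcongr
      _ ≤ 1 + L := by rw [h11]; linarith
  rw [h1]
  calc |a|⁻¹ * ∫ u in (0 : ℝ)..|a|, f u ≤ |a|⁻¹ * (n * Real.sqrt (Real.pi ^ 3 / (2 * K))) := by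
        gcongr
        exact h2.trans (by gcongr)
    _ = (|a|⁻¹ * n) * Real.sqrt (Real.pi ^ 3 / (2 * K)) := by ring
    _ ≤ _ := by gcongr

/-- The weights have no upper bound, so no common quadratic estimate exists. Convexity of `exp`
replaces the sum by an average of single-weight integrals with exponent multiplied by `A.card`. -/
theorem integral_exp_le_of_le_abs {ι : Type*} (hk : 1 ≤ k) (A : Finset ι) (hA : A.Nonempty)
    (a : ι → ℝ) {L : ℝ} (hL : 0 < L) (ha : ∀ c ∈ A, 1 / L ≤ |a c|) :
    ∫ t in (0 : ℝ)..1, Real.exp (-(1 / (4 * (k : ℝ) ^ 2)) * ∑ c ∈ A, (1 - Real.cos (t * a c))) ≤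
      (1 + L) * (8 * k / Real.sqrt A.card) := by
  have hk1 : (1 : ℝ) ≤ k := by exact_mod_cast hk
  have hm : (0 : ℝ) < A.card := by exact_mod_cast hA.card_pos
  set κ : ℝ := 1 / (4 * (k : ℝ) ^ 2) with hκ
  have hκ0 : 0 < κ := by positivity
  have hjensen : ∀ t : ℝ, Real.exp (-κ * ∑ c ∈ A, (1 - Real.cos (t * a c))) ≤
      ∑ c ∈ A, (A.card : ℝ)⁻¹ * Real.exp (-(A.card * κ) * (1 - Real.cos (t * a c))) := by
    intro t
    have h := convexOn_exp.map_sum_le (t := A) (w := fun _ => (A.card : ℝ)⁻¹)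
      (p := fun c => -(A.card * κ) * (1 - Real.cos (t * a c))) (fun _ _ => by positivity)
      (by simp [hm.ne']) (fun _ _ => Set.mem_univ _)
    simp only [smul_eq_mul] at h
    refine le_trans (le_of_eq ?_) h
    congr 1
    rw [Finset.mul_sum]
    refine Finset.sum_congr rfl fun c _ => ?_
    field_simp
  have h1 : ∫ t in (0 : ℝ)..1, Real.exp (-κ * ∑ c ∈ A, (1 - Real.cos (t * a c))) ≤
      ∑ c ∈ A, (A.card : ℝ)⁻¹ *
        ∫ t in (0 : ℝ)..1, Real.exp (-(A.card * κ) * (1 - Real.cos (t * a c))) := by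
    simp only [← intervalIntegral.integral_const_mul]
    rw [← intervalIntegral.integral_finsetSum fun c _ => by
      apply Continuous.intervalIntegrable; fun_prop]
    exact intervalIntegral.integral_mono_on (by norm_num)
      (by apply Continuous.intervalIntegrable; fun_prop)
      (by apply Continuous.intervalIntegrable; fun_prop) fun t _ => hjensen t
  have h2 : Real.sqrt (Real.pi ^ 3 / (2 * (A.card * κ))) ≤ 8 * k / Real.sqrt A.card := by
    rw [Real.sqrt_le_left (by positivity), div_pow, Real.sq_sqrt hm.le, hκ]
    have e : Real.pi ^ 3 / (2 * (A.card * (1 / (4 * (k : ℝ) ^ 2)))) =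
        2 * Real.pi ^ 3 * (k : ℝ) ^ 2 / A.card := by field_simp; norm_num
    rw [e]
    refine div_le_div_of_nonneg_right ?_ hm.le
    have hpi : 2 * Real.pi ^ 3 ≤ 64 := by
      have h3 := Real.pi_lt_d2
      have h4 : Real.pi ^ 3 ≤ 3.15 ^ 3 := pow_le_pow_left₀ Real.pi_pos.le h3.le 3
      norm_num at h4
      linarith
    nlinarith [sq_nonneg (k : ℝ)]
  refine h1.trans ?_
  calc ∑ c ∈ A, (A.card : ℝ)⁻¹ *
        ∫ t in (0 : ℝ)..1, Real.exp (-(A.card * κ) * (1 - Real.cos (t * a c)))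
      ≤ ∑ c ∈ A, (A.card : ℝ)⁻¹ * ((1 + L) * (8 * k / Real.sqrt A.card)) := by
        refine Finset.sum_le_sum fun c hc => mul_le_mul_of_nonneg_left ?_ (by positivity)
        exact (integral_exp_cos_le (by positivity) hL (ha c hc)).trans
          (mul_le_mul_of_nonneg_left h2 (by linarith))
    _ = _ := by
        rw [Finset.sum_const, nsmul_eq_mul, ← mul_assoc, mul_inv_cancel₀ hm.ne', one_mul]

end

section

variable {k M N : ℕ}

/-! ### Fourth powers of fibre weights -/

/-- Split off the largest term `w_m`. The rest `b` satisfies `b² ≤ dQ` with `Q ≤ d w_m²`, so `b⁴ ≤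
d³ w_m² Q`, and `w_m² Q` is part of the sum over distinct pairs. -/
theorem sum_abs_pow_four_le {ι : Type*} [DecidableEq ι] (A : Finset ι) (w : ι → ℝ) {d : ℕ}
    (hd : A.card ≤ d) :
    (∑ i ∈ A, |w i|) ^ 4 ≤ 8 * ∑ i ∈ A, w i ^ 4 +
      8 * (d : ℝ) ^ 3 * ∑ i ∈ A, ∑ j ∈ A, if i ≠ j then w i ^ 2 * w j ^ 2 else 0 := by
  have hin : ∀ i j, 0 ≤ if i ≠ j then w i ^ 2 * w j ^ 2 else 0 := fun i j => by positivity
  rcases A.eq_empty_or_nonempty with rfl | hA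
  · simp
  obtain ⟨m, hm, hmax⟩ := Finset.exists_max_image A (fun i => |w i|) hA
  set b : ℝ := ∑ i ∈ A.erase m, |w i| with hb
  set Q : ℝ := ∑ i ∈ A.erase m, w i ^ 2 with hQ
  have hQ0 : 0 ≤ Q := Finset.sum_nonneg fun i _ => sq_nonneg _
  have hd' : ((A.erase m).card : ℝ) ≤ d := by
    exact_mod_cast (Finset.card_le_card (Finset.erase_subset _ _)).trans hd
  have hb2 : b ^ 2 ≤ d * Q := by
    refine (sq_sum_le_card_mul_sum_sq).trans ?_
    simp only [sq_abs]
    exact mul_le_mul_of_nonneg_right hd' hQ0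
  have hQd : Q ≤ d * w m ^ 2 := by
    refine (Finset.sum_le_card_nsmul _ _ (w m ^ 2) fun i hi => ?_).trans ?_
    · exact sq_le_sq.2 (hmax i (Finset.mem_of_mem_erase hi))
    · rw [nsmul_eq_mul]
      exact mul_le_mul_of_nonneg_right hd' (sq_nonneg _)
  have hb4 : b ^ 4 ≤ d ^ 3 * (w m ^ 2 * Q) := by
    calc b ^ 4 = (b ^ 2) ^ 2 := by ring
      _ ≤ (d * Q) ^ 2 := by gcongr
      _ = d ^ 2 * Q * Q := by ring
      _ ≤ d ^ 2 * Q * (d * w m ^ 2) := by gcongr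
      _ = _ := by ring
  have hcoll : w m ^ 2 * Q ≤ ∑ i ∈ A, ∑ j ∈ A, if i ≠ j then w i ^ 2 * w j ^ 2 else 0 := by
    refine le_trans ?_ (Finset.single_le_sum
      (f := fun i => ∑ j ∈ A, if i ≠ j then w i ^ 2 * w j ^ 2 else 0)
      (fun i _ => Finset.sum_nonneg fun j _ => hin i j) hm)
    rw [hQ, Finset.mul_sum]
    refine le_trans (le_of_eq ?_) (Finset.sum_le_sum_of_subset_of_nonneg (Finset.erase_subset m A)
      fun j _ _ => hin m j)
    exact Finset.sum_congr rfl fun j hj => by rw [if_pos (Finset.ne_of_mem_erase hj).symm]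
  have hsum4 : |w m| ^ 4 ≤ ∑ i ∈ A, w i ^ 4 := by
    rw [Even.pow_abs (by decide : Even 4)]
    exact Finset.single_le_sum (f := fun i => w i ^ 4) (fun i _ => by positivity) hm
  rw [← Finset.add_sum_erase A _ hm, ← hb]
  have h8 : (|w m| + b) ^ 4 ≤ 8 * (|w m| ^ 4 + b ^ 4) := by
    have h1 : (|w m| + b) ^ 2 ≤ 2 * (|w m| ^ 2 + b ^ 2) := by nlinarith [sq_nonneg (|w m| - b)]
    calc (|w m| + b) ^ 4 = ((|w m| + b) ^ 2) ^ 2 := by ring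
      _ ≤ (2 * (|w m| ^ 2 + b ^ 2)) ^ 2 := by gcongr
      _ ≤ _ := by nlinarith [sq_nonneg (|w m| ^ 2 - b ^ 2)]
  have h9 := mul_le_mul_of_nonneg_left hcoll (by positivity : (0 : ℝ) ≤ (d : ℝ) ^ 3)
  linarith

open scoped Classical in
/-- The total weight of the pairs of distinct labels in `R` that have the same projection. -/
noncomputable def collisionWeight (π : Fin M → Fin N) (R : Finset (Fin M)) (w : Fin M → ℝ) : ℝ :=
  ∑ i ∈ R, ∑ j ∈ R, if i ≠ j ∧ π i = π j then w i ^ 2 * w j ^ 2 else 0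

theorem collisionWeight_nonneg (π : Fin M → Fin N) (R : Finset (Fin M)) (w : Fin M → ℝ) :
    0 ≤ collisionWeight π R w :=
  Finset.sum_nonneg fun i _ => Finset.sum_nonneg fun j _ => by positivity

theorem collisionWeight_le (π : Fin M → Fin N) (R : Finset (Fin M)) (w : Fin M → ℝ) :
    collisionWeight π R w ≤ (∑ i ∈ R, w i ^ 2) ^ 2 := by
  rw [sq (∑ i ∈ R, w i ^ 2), Finset.sum_mul_sum]
  refine Finset.sum_le_sum fun i _ => Finset.sum_le_sum fun j _ => ?_
  split_ifs
  · exact le_rfl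
  · positivity

theorem collisionWeight_smul (π : Fin M → Fin N) (R : Finset (Fin M)) (w : Fin M → ℝ) (s : ℝ) :
    collisionWeight π R (fun j => s * w j) = s ^ 4 * collisionWeight π R w := by
  simp only [collisionWeight, Finset.mul_sum]
  refine Finset.sum_congr rfl fun i _ => Finset.sum_congr rfl fun j _ => ?_
  split_ifs <;> ring

theorem sum_fiber_pow_four_le (π : Fin M → Fin N) (R : Finset (Fin M)) (w : Fin M → ℝ) {d : ℕ}
    (hd : ∀ n, (Finset.univ.filter fun j => π j = n).card ≤ d) :
    ∑ n, (∑ j ∈ R with π j = n, |w j|) ^ 4 ≤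
      8 * ∑ j ∈ R, w j ^ 4 + 8 * (d : ℝ) ^ 3 * collisionWeight π R w := by
  classical
  have h1 : ∀ n, (∑ j ∈ R with π j = n, |w j|) ^ 4 ≤ _ := fun n =>
    sum_abs_pow_four_le (R.filter fun j => π j = n) w
      ((Finset.card_le_card (Finset.filter_subset_filter _ (Finset.subset_univ R))).trans (hd n))
  refine (Finset.sum_le_sum fun n _ => h1 n).trans (le_of_eq ?_)
  rw [Finset.sum_add_distrib, ← Finset.mul_sum, ← Finset.mul_sum, Finset.sum_fiberwise]
  congr 2
  have h2 : ∀ n, (∑ i ∈ R with π i = n, ∑ j ∈ R with π j = n,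
      if i ≠ j then w i ^ 2 * w j ^ 2 else 0) = ∑ i ∈ R with π i = n, ∑ j ∈ R,
      if i ≠ j ∧ π i = π j then w i ^ 2 * w j ^ 2 else 0 := by
    intro n
    refine Finset.sum_congr rfl fun i hi => ?_
    obtain ⟨-, rfl⟩ := Finset.mem_filter.1 hi
    rw [Finset.sum_filter]
    refine Finset.sum_congr rfl fun j _ => ?_
    by_cases h3 : i ≠ j <;> by_cases h4 : π i = π j <;> simp [h3, h4, eq_comm]
  simp only [h2]
  rw [Finset.sum_fiberwise]
  rfl

/-! ### Comparison of the two labels for one hyperedge -/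

/-- The value of a linear form at the blocks of one hyperedge. -/
def blockSum (W : Fin k → Fin M → ℝ) (z : Fin k → Fin M → Bool) : ℝ :=
  ∑ p, ∑ j, W p j * bit (z p j)

open scoped Classical in
/-- The probability that a linear threshold function of the blocks is `1`. -/
noncomputable def acceptProb (hk : 12 ^ 6 ≤ k) (π : Fin k → Fin M → Fin N) (b : Bool)
    (W : Fin k → Fin M → ℝ) (θ : ℝ) : ℝ :=
  blockExpect hk π b fun z => if θ ≤ blockSum W z then 1 else 0

theorem blockSum_smul (W : Fin k → Fin M → ℝ) (s : ℝ) (z : Fin k → Fin M → Bool) :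
    blockSum (fun p j => s * W p j) z = s * blockSum W z := by
  simp only [blockSum, Finset.mul_sum, mul_assoc]

theorem acceptProb_smul (hk : 12 ^ 6 ≤ k) (π : Fin k → Fin M → Fin N) (b : Bool)
    (W : Fin k → Fin M → ℝ) (θ : ℝ) {s : ℝ} (hs : 0 < s) :
    acceptProb hk π b (fun p j => s * W p j) (s * θ) = acceptProb hk π b W θ := by
  simp only [acceptProb, blockSum_smul, mul_le_mul_iff_right₀ hs]

theorem sum_pow_four_le {ι : Type*} (s : Finset ι) (a : ι → ℝ) :
    (∑ i ∈ s, a i) ^ 4 ≤ (s.card : ℝ) ^ 3 * ∑ i ∈ s, a i ^ 4 := by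
  have h1 : (∑ i ∈ s, a i) ^ 2 ≤ s.card * ∑ i ∈ s, a i ^ 2 := sq_sum_le_card_mul_sum_sq
  have h2 : (∑ i ∈ s, a i ^ 2) ^ 2 ≤ s.card * ∑ i ∈ s, (a i ^ 2) ^ 2 := sq_sum_le_card_mul_sum_sq
  calc (∑ i ∈ s, a i) ^ 4 = ((∑ i ∈ s, a i) ^ 2) ^ 2 := by ring
    _ ≤ (s.card * ∑ i ∈ s, a i ^ 2) ^ 2 := by gcongr
    _ = (s.card : ℝ) ^ 2 * (∑ i ∈ s, a i ^ 2) ^ 2 := by ring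
    _ ≤ (s.card : ℝ) ^ 2 * (s.card * ∑ i ∈ s, (a i ^ 2) ^ 2) := by gcongr
    _ = _ := by simp only [← pow_mul]; ring

open scoped Classical in
-- The shifted step is 1 from `θ` on and 0 below `θ - 1`, so it dominates the threshold and exceeds
-- it only in a window of length 1. The factor `k ^ 3` is the power mean inequality over the
-- vertices.
theorem acceptProb_sub_le_of_taylor (hk : 12 ^ 6 ≤ k) {K : ℝ} (hK : 0 ≤ K)
    (hφ : HasTaylorBound Real.smoothTransition K) (π : Fin k → Fin M → Fin N) {d : ℕ}
    (hd : ∀ p n, (Finset.univ.filter fun j => π p j = n).card ≤ d) (H : Fin k → Finset (Fin M))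
    (hH : ∀ p q, ∀ i ∈ H p, ∀ j ∈ H q, π p i = π q j → p = q) (W : Fin k → Fin M → ℝ) (θ : ℝ) :
    acceptProb hk π true W θ - acceptProb hk π false W θ ≤
      16 * K * (k : ℝ) ^ 3 * ∑ p, (∑ j ∈ (H p)ᶜ, W p j ^ 4 +
        (d : ℝ) ^ 3 * collisionWeight (π p) (H p)ᶜ (W p)) +
      blockExpect hk π false fun z =>
        if blockSum W z < θ ∧ |blockSum W z - θ| ≤ 1 then (1 : ℝ) else 0 := by
  have h1 := (abs_le.1 (abs_blockExpect_sub_le hk hK hφ π H hH W (1 - θ))).2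
  have h2 : acceptProb hk π true W θ ≤
      blockExpect hk π true fun z => Real.smoothTransition (1 - θ + blockSum W z) := by
    refine blockExpect_mono hk π true fun z => ?_
    split_ifs with h
    · exact (Real.smoothTransition.one_of_one_le (by linarith)).ge
    · exact Real.smoothTransition.nonneg _
  have h3 : (blockExpect hk π false fun z => Real.smoothTransition (1 - θ + blockSum W z)) ≤
      acceptProb hk π false W θ + blockExpect hk π false fun z =>
        if blockSum W z < θ ∧ |blockSum W z - θ| ≤ 1 then (1 : ℝ) else 0 := by
    rw [acceptProb, ← blockExpect_add]
    refine blockExpect_mono hk π false fun z => ?_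
    by_cases h : θ ≤ blockSum W z
    · simp only [h, if_true, not_lt.2 h, false_and, if_false, add_zero]
      exact Real.smoothTransition.le_one _
    · by_cases h' : |blockSum W z - θ| ≤ 1
      · simp only [h, h', if_false, not_le.1 h, and_self, if_true, zero_add]
        exact Real.smoothTransition.le_one _
      · simp only [h, h', if_false, and_false, add_zero]
        refine (Real.smoothTransition.zero_of_nonpos ?_).le
        by_contra! hc
        exact h' (abs_le.2 ⟨by linarith, by linarith⟩)
  have h4 : ∑ n, 2 * K * (∑ p, fiberWeight π H W n p) ^ 4 ≤
      16 * K * (k : ℝ) ^ 3 * ∑ p, (∑ j ∈ (H p)ᶜ, W p j ^ 4 +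
        (d : ℝ) ^ 3 * collisionWeight (π p) (H p)ᶜ (W p)) := by
    calc ∑ n, 2 * K * (∑ p, fiberWeight π H W n p) ^ 4
        ≤ ∑ n, 2 * K * ((k : ℝ) ^ 3 * ∑ p, fiberWeight π H W n p ^ 4) := by
          refine Finset.sum_le_sum fun n _ => mul_le_mul_of_nonneg_left ?_ (by positivity)
          simpa using sum_pow_four_le Finset.univ (fiberWeight π H W n)
      _ = 2 * K * (k : ℝ) ^ 3 * ∑ p, ∑ n, fiberWeight π H W n p ^ 4 := by
          rw [Finset.sum_comm (s := Finset.univ (α := Fin k)), Finset.mul_sum]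
          exact Finset.sum_congr rfl fun n _ => by ring
      _ ≤ 2 * K * (k : ℝ) ^ 3 * ∑ p, (8 * ∑ j ∈ (H p)ᶜ, W p j ^ 4 +
            8 * (d : ℝ) ^ 3 * collisionWeight (π p) (H p)ᶜ (W p)) := by
          refine mul_le_mul_of_nonneg_left (Finset.sum_le_sum fun p _ => ?_) (by positivity)
          refine le_trans (le_of_eq ?_) (sum_fiber_pow_four_le (π p) (H p)ᶜ (W p) (hd p))
          refine Finset.sum_congr rfl fun n _ => ?_
          rw [fiberWeight]
      _ = _ := by
          rw [Finset.mul_sum, Finset.mul_sum]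
          exact Finset.sum_congr rfl fun p _ => by ring
  have h5 : ∀ b, (blockExpect hk π b fun z => Real.smoothTransition (1 - θ + blockSum W z)) =
    blockExpect hk π b (fun z => Real.smoothTransition
      (1 - θ + ∑ p, ∑ j, W p j * bit (z p j))) := fun b => rfl
  rw [h5] at h2 h3
  linarith

/-! ### Rescaling the light weights and combining the error terms -/

/-- The collision weight relative to the square of the total weight. -/
noncomputable def collisionRatio (π : Fin M → Fin N) (R : Finset (Fin M)) (w : Fin M → ℝ) : ℝ :=
  collisionWeight π R w / (∑ i ∈ R, w i ^ 2) ^ 2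

theorem collisionRatio_nonneg (π : Fin M → Fin N) (R : Finset (Fin M)) (w : Fin M → ℝ) :
    0 ≤ collisionRatio π R w := div_nonneg (collisionWeight_nonneg _ _ _) (sq_nonneg _)

theorem collisionRatio_smul (π : Fin M → Fin N) (R : Finset (Fin M)) (w : Fin M → ℝ) {s : ℝ}
    (hs : 0 < s) : collisionRatio π R (fun j => s * w j) = collisionRatio π R w := by
  rw [collisionRatio, collisionWeight_smul, collisionRatio]
  simp only [mul_pow, ← Finset.mul_sum]
  rw [← pow_mul, mul_div_mul_left _ _ (by positivity)]

/-- With zero total weight the quotient is 0 by convention, and the collision weight vanishes too.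
-/
theorem collisionWeight_eq (π : Fin M → Fin N) (R : Finset (Fin M)) (w : Fin M → ℝ) :
    collisionWeight π R w = collisionRatio π R w * (∑ i ∈ R, w i ^ 2) ^ 2 := by
  rcases eq_or_ne ((∑ i ∈ R, w i ^ 2) ^ 2) 0 with h | h
  · rw [h, mul_zero]
    exact le_antisymm (h ▸ collisionWeight_le π R w) (collisionWeight_nonneg π R w)
  · rw [collisionRatio, div_mul_cancel₀ _ h]

theorem sum_compl_eq_sum_filter (H : Fin k → Finset (Fin M)) (f : Fin k → Fin M → ℝ) :
    ∑ c : Fin k × Fin M with c.2 ∉ H c.1, f c.1 c.2 = ∑ p, ∑ j ∈ (H p)ᶜ, f p j := by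
  rw [Finset.sum_filter, Fintype.sum_prod_type]
  refine Finset.sum_congr rfl fun p _ => ?_
  rw [← Finset.sum_filter]
  congr 1
  ext j
  simp

/-- The linear form outside `H` has second moment at most `k ^ 4` and entries at most `k ^ (-5)`,
and attains one of these two bounds. -/
structure IsNormalized (H : Fin k → Finset (Fin M)) (W : Fin k → Fin M → ℝ) : Prop where
  sum_sq_le : ∑ p, ∑ j ∈ (H p)ᶜ, W p j ^ 2 ≤ (k : ℝ) ^ 4
  abs_le : ∀ p, ∀ j ∉ H p, |W p j| ≤ 1 / (k : ℝ) ^ 5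
  attained : ∑ p, ∑ j ∈ (H p)ᶜ, W p j ^ 2 = (k : ℝ) ^ 4 ∨
    ∃ p, ∃ j ∉ H p, |W p j| = 1 / (k : ℝ) ^ 5

open scoped Classical in
theorem blockExpect_smallBall_le (hk : 12 ^ 6 ≤ k) (π : Fin k → Fin M → Fin N) (b : Bool)
    (H : Fin k → Finset (Fin M)) (W : Fin k → Fin M → ℝ) (hW : IsNormalized H W)
    (hcard : ∀ p, H p = Finset.univ ∨ (H p).card = k ^ 14)
    (htop : ∀ p, ∀ i ∈ H p, ∀ j ∉ H p, |W p j| ≤ |W p i|) (θ : ℝ) :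
    (blockExpect hk π b fun z => if |blockSum W z - θ| ≤ 1 then (1 : ℝ) else 0) ≤ 80 / k := by
  have hk1 : 1 ≤ k := le_trans (by norm_num) hk
  have hk1' : (1 : ℝ) ≤ k := by exact_mod_cast hk1
  have hk0 : (0 : ℝ) < k := by linarith
  -- First case: the light coordinates give `5 · 8k / k²`. Second case: a label outside `H p`
  -- exists, so `H p` has exactly `k ^ 14` elements, all of weight at least `k ^ (-5)`, which gives
  -- `5 (1 + k⁵) · 8k / k⁷`.
  rcases hW.attained with hV | ⟨p, j, hj, hpj⟩
  · set A : Finset (Fin k × Fin M) := Finset.univ.filter fun c => c.2 ∉ H c.1 with hA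
    have hsum : ∑ c ∈ A, W c.1 c.2 ^ 2 = (k : ℝ) ^ 4 := by
      rw [hA, sum_compl_eq_sum_filter H fun p j => W p j ^ 2, hV]
    have h1 : ∀ c ∈ A, |W c.1 c.2| ≤ 1 := fun c hc => by
      refine (hW.abs_le c.1 c.2 (Finset.mem_filter.1 hc).2).trans ?_
      rw [div_le_one (by positivity)]
      exact one_le_pow₀ hk1'
    have h2 := integral_exp_le_of_abs_le_one hk1 A (fun c => W c.1 c.2) h1 (by rw [hsum]; positivity)
    rw [hsum] at h2
    have h3 : Real.sqrt ((k : ℝ) ^ 4) = (k : ℝ) ^ 2 := by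
      rw [show (k : ℝ) ^ 4 = ((k : ℝ) ^ 2) ^ 2 by ring, Real.sqrt_sq (by positivity)]
    rw [h3] at h2
    refine (blockExpect_abs_le_one_le hk π b W θ A).trans ?_
    refine (mul_le_mul_of_nonneg_left h2 (by norm_num)).trans ?_
    rw [← mul_div_assoc, div_le_div_iff₀ (by positivity) hk0]
    nlinarith [sq_nonneg (k : ℝ)]
  · have hcp : (H p).card = k ^ 14 := (hcard p).resolve_left fun h => hj (h ▸ Finset.mem_univ j)
    set A : Finset (Fin k × Fin M) := (H p).map ⟨fun i => (p, i), fun _ _ h => (Prod.ext_iff.1 h).2⟩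
      with hA
    have hAc : A.card = k ^ 14 := by rw [hA, Finset.card_map, hcp]
    have hAn : A.Nonempty := Finset.card_pos.1 (by rw [hAc]; positivity)
    have h1 : ∀ c ∈ A, 1 / (k : ℝ) ^ 5 ≤ |W c.1 c.2| := by
      intro c hc
      obtain ⟨i, hi, rfl⟩ := Finset.mem_map.1 hc
      rw [← hpj]
      exact htop p i hi j hj
    have h2 := integral_exp_le_of_le_abs hk1 A hAn (fun c => W c.1 c.2) (by positivity) h1
    have h3 : Real.sqrt (A.card : ℝ) = (k : ℝ) ^ 7 := by
      rw [hAc, Nat.cast_pow, show (k : ℝ) ^ 14 = ((k : ℝ) ^ 7) ^ 2 by ring,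
        Real.sqrt_sq (by positivity)]
    rw [h3] at h2
    refine (blockExpect_abs_le_one_le hk π b W θ A).trans ?_
    refine (mul_le_mul_of_nonneg_left h2 (by norm_num)).trans ?_
    rw [show 5 * ((1 + (k : ℝ) ^ 5) * (8 * k / (k : ℝ) ^ 7)) =
      40 * (1 + (k : ℝ) ^ 5) / (k : ℝ) ^ 6 by field_simp; ring,
      div_le_div_iff₀ (by positivity) hk0]
    have := one_le_pow₀ hk1' (n := 5)
    nlinarith

theorem acceptProb_sub_le_of_isNormalized (hk : 12 ^ 6 ≤ k) {K : ℝ} (hK : 0 ≤ K)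
    (hφ : HasTaylorBound Real.smoothTransition K) (π : Fin k → Fin M → Fin N) {d : ℕ}
    (hd : ∀ p n, (Finset.univ.filter fun j => π p j = n).card ≤ d) (H : Fin k → Finset (Fin M))
    (hH : ∀ p q, ∀ i ∈ H p, ∀ j ∈ H q, π p i = π q j → p = q) (W : Fin k → Fin M → ℝ)
    (hW : IsNormalized H W) (hcard : ∀ p, H p = Finset.univ ∨ (H p).card = k ^ 14)
    (htop : ∀ p, ∀ i ∈ H p, ∀ j ∉ H p, |W p j| ≤ |W p i|) (θ : ℝ) :
    acceptProb hk π true W θ - acceptProb hk π false W θ ≤ (16 * K + 80) / k +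
      16 * K * (k : ℝ) ^ 11 * (d : ℝ) ^ 3 * ∑ p, collisionRatio (π p) (H p)ᶜ (W p) := by
  have hk1 : 1 ≤ k := le_trans (by norm_num) hk
  have hk1' : (1 : ℝ) ≤ k := by exact_mod_cast hk1
  have hk0 : (0 : ℝ) < k := by linarith
  have h1 := acceptProb_sub_le_of_taylor hk hK hφ π hd H hH W θ
  have h2 := blockExpect_smallBall_le hk π false H W hW hcard htop θ
  have h3 : (blockExpect hk π false fun z =>
        if blockSum W z < θ ∧ |blockSum W z - θ| ≤ 1 then (1 : ℝ) else 0) ≤ 80 / k := by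
    refine le_trans (blockExpect_mono hk π false fun z => ?_) h2
    split_ifs <;> simp_all
  have h4 : ∑ p, ∑ j ∈ (H p)ᶜ, W p j ^ 4 ≤ 1 / (k : ℝ) ^ 6 := by
    calc ∑ p, ∑ j ∈ (H p)ᶜ, W p j ^ 4 ≤ ∑ p, ∑ j ∈ (H p)ᶜ, (1 / (k : ℝ) ^ 5) ^ 2 * W p j ^ 2 := by
          refine Finset.sum_le_sum fun p _ => Finset.sum_le_sum fun j hj => ?_
          rw [show W p j ^ 4 = W p j ^ 2 * W p j ^ 2 by ring, ← sq_abs (W p j)]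
          have := hW.abs_le p j (Finset.mem_compl.1 hj)
          gcongr
      _ = (1 / (k : ℝ) ^ 5) ^ 2 * ∑ p, ∑ j ∈ (H p)ᶜ, W p j ^ 2 := by simp only [Finset.mul_sum]
      _ ≤ (1 / (k : ℝ) ^ 5) ^ 2 * (k : ℝ) ^ 4 := by gcongr; exact hW.sum_sq_le
      _ = _ := by field_simp
  have h5 : ∀ p, collisionWeight (π p) (H p)ᶜ (W p) ≤
      (k : ℝ) ^ 8 * collisionRatio (π p) (H p)ᶜ (W p) := by
    intro p
    have h6 : ∑ j ∈ (H p)ᶜ, W p j ^ 2 ≤ (k : ℝ) ^ 4 :=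
      le_trans (Finset.single_le_sum (f := fun p => ∑ j ∈ (H p)ᶜ, W p j ^ 2)
        (fun q _ => Finset.sum_nonneg fun j _ => sq_nonneg _) (Finset.mem_univ p)) hW.sum_sq_le
    rw [collisionWeight_eq, mul_comm, show (k : ℝ) ^ 8 = ((k : ℝ) ^ 4) ^ 2 by ring]
    have h7 : 0 ≤ ∑ j ∈ (H p)ᶜ, W p j ^ 2 := Finset.sum_nonneg fun j _ => sq_nonneg _
    have := collisionRatio_nonneg (π p) (H p)ᶜ (W p)
    gcongr
  have h8 : ∑ p, (∑ j ∈ (H p)ᶜ, W p j ^ 4 + (d : ℝ) ^ 3 * collisionWeight (π p) (H p)ᶜ (W p)) ≤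
      1 / (k : ℝ) ^ 6 +
        (d : ℝ) ^ 3 * ((k : ℝ) ^ 8 * ∑ p, collisionRatio (π p) (H p)ᶜ (W p)) := by
    rw [Finset.sum_add_distrib, ← Finset.mul_sum, Finset.mul_sum (a := (k : ℝ) ^ 8)]
    gcongr
    exact h5 _
  have h9 := mul_le_mul_of_nonneg_left h8 (by positivity : 0 ≤ 16 * K * (k : ℝ) ^ 3)
  have h10 : 16 * K * (k : ℝ) ^ 3 * (1 / (k : ℝ) ^ 6) ≤ 16 * K / k := by
    rw [show 16 * K * (k : ℝ) ^ 3 * (1 / (k : ℝ) ^ 6) = 16 * K * (1 / (k : ℝ) ^ 3) by field_simp,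
      show 16 * K / (k : ℝ) = 16 * K * (1 / (k : ℝ) ^ 1) by rw [pow_one]; ring]
    gcongr
    norm_num
  rw [add_div]
  rw [mul_add] at h9
  linarith

/-- With no light weights nothing can be normalized, but then there is no Taylor error. Finitely
many inputs leave a positive gap `g` below the threshold, and scaling by `2 / g` empties the window.
-/
theorem acceptProb_sub_le_of_eq_zero (hk : 12 ^ 6 ≤ k) {K : ℝ} (hK : 0 ≤ K)
    (hφ : HasTaylorBound Real.smoothTransition K) (π : Fin k → Fin M → Fin N)
    (H : Fin k → Finset (Fin M))
    (hH : ∀ p q, ∀ i ∈ H p, ∀ j ∈ H q, π p i = π q j → p = q) (W : Fin k → Fin M → ℝ)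
    (hW : ∀ p, ∀ j ∉ H p, W p j = 0) (θ : ℝ) :
    acceptProb hk π true W θ - acceptProb hk π false W θ ≤ 0 := by
  classical
  obtain ⟨z₀, hz₀⟩ := Finite.exists_min fun z : Fin k → Fin M → Bool =>
    if blockSum W z < θ then θ - blockSum W z else 1
  set g : ℝ := if blockSum W z₀ < θ then θ - blockSum W z₀ else 1 with hg
  have hg0 : 0 < g := by
    rw [hg]
    split_ifs with h
    · linarith
    · norm_num
  set s : ℝ := 2 / g with hs
  have hs0 : 0 < s := by positivity
  have h1 := acceptProb_sub_le_of_taylor hk hK hφ π (d := M)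
    (fun p n => (Finset.card_le_univ _).trans_eq (Fintype.card_fin M)) H hH
    (fun p j => s * W p j) (s * θ)
  rw [acceptProb_smul hk π _ W θ hs0, acceptProb_smul hk π _ W θ hs0] at h1
  have hR : ∀ p, ∀ j ∈ (H p)ᶜ, W p j = 0 := fun p j hj => hW p j (Finset.mem_compl.1 hj)
  have h2 : ∑ p, (∑ j ∈ (H p)ᶜ, (s * W p j) ^ 4 +
      (M : ℝ) ^ 3 * collisionWeight (π p) (H p)ᶜ fun j => s * W p j) = 0 := by
    refine Finset.sum_eq_zero fun p _ => ?_
    rw [collisionWeight_eq, Finset.sum_eq_zero fun j hj => by rw [hR p j hj]; ring,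
      Finset.sum_eq_zero fun j hj => by rw [hR p j hj]; ring]
    ring
  have h3 : (blockExpect hk π false fun z => if blockSum (fun p j => s * W p j) z < s * θ ∧
      |blockSum (fun p j => s * W p j) z - s * θ| ≤ 1 then (1 : ℝ) else 0) ≤ 0 := by
    refine blockExpect_le hk π false fun z => ?_
    rw [if_neg]
    rintro ⟨h4, h5⟩
    rw [blockSum_smul] at h4 h5
    have h6 : blockSum W z < θ := lt_of_mul_lt_mul_left h4 hs0.le
    have h7 := hz₀ z
    rw [if_pos h6] at h7
    rw [← mul_sub, abs_mul, abs_of_pos hs0, abs_of_neg (by linarith)] at h5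
    have h8 : s * g = 2 := by rw [hs]; field_simp
    nlinarith
  rw [h2, mul_zero, zero_add] at h1
  exact h1.trans h3

theorem exists_pos_isNormalized_smul (hk : 1 ≤ k) (H : Fin k → Finset (Fin M))
    (W : Fin k → Fin M → ℝ) (hW : ∃ p, ∃ j ∉ H p, W p j ≠ 0) :
    ∃ s : ℝ, 0 < s ∧ IsNormalized H fun p j => s * W p j := by
  have hk1' : (1 : ℝ) ≤ k := by exact_mod_cast hk
  have hk0 : (0 : ℝ) < k := by linarith
  obtain ⟨p₀, j₀, hj₀, hne⟩ := hW
  set A : Finset (Fin k × Fin M) := Finset.univ.filter fun c => c.2 ∉ H c.1 with hA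
  obtain ⟨m, hm, hmax⟩ := Finset.exists_max_image A (fun c => |W c.1 c.2|)
    ⟨(p₀, j₀), by simpa [hA] using hj₀⟩
  set μ : ℝ := |W m.1 m.2| with hμ
  have hm' : m.2 ∉ H m.1 := (Finset.mem_filter.1 hm).2
  have hmax' : ∀ p, ∀ j ∉ H p, |W p j| ≤ μ := fun p j hj => hmax (p, j) (by simpa [hA] using hj)
  have hμ0 : 0 < μ := lt_of_lt_of_le (abs_pos.2 hne) (hmax' p₀ j₀ hj₀)
  set V : ℝ := ∑ p, ∑ j ∈ (H p)ᶜ, W p j ^ 2 with hV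
  have hV0 : 0 ≤ V := Finset.sum_nonneg fun p _ => Finset.sum_nonneg fun j _ => sq_nonneg _
  -- Dividing by `r` enforces both bounds, and the larger entry of the maximum is the one attained.
  set r : ℝ := max (Real.sqrt V / (k : ℝ) ^ 2) ((k : ℝ) ^ 5 * μ) with hr
  have hr0 : 0 < r := lt_of_lt_of_le (by positivity) (le_max_right _ _)
  have hsum : ∑ p, ∑ j ∈ (H p)ᶜ, (r⁻¹ * W p j) ^ 2 = V / r ^ 2 := by
    simp only [mul_pow, ← Finset.mul_sum]
    rw [← hV, inv_pow, inv_mul_eq_div]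
  have habs : ∀ p j, |r⁻¹ * W p j| = |W p j| / r := fun p j => by
    rw [abs_mul, abs_of_pos (inv_pos.2 hr0), inv_mul_eq_div]
  refine ⟨r⁻¹, inv_pos.2 hr0, ⟨?_, ?_, ?_⟩⟩
  · rw [hsum, div_le_iff₀ (by positivity)]
    have h1 : Real.sqrt V ≤ r * (k : ℝ) ^ 2 := by
      rw [← div_le_iff₀ (by positivity)]
      exact le_max_left _ _
    calc V = Real.sqrt V ^ 2 := (Real.sq_sqrt hV0).symm
      _ ≤ (r * (k : ℝ) ^ 2) ^ 2 := by gcongr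
      _ = _ := by ring
  · intro p j hj
    rw [habs, div_le_div_iff₀ hr0 (by positivity), one_mul]
    have h1 : (k : ℝ) ^ 5 * μ ≤ r := le_max_right _ _
    have h2 := hmax' p j hj
    calc |W p j| * (k : ℝ) ^ 5 ≤ μ * (k : ℝ) ^ 5 := by gcongr
      _ ≤ r := by linarith
  · rcases max_choice (Real.sqrt V / (k : ℝ) ^ 2) ((k : ℝ) ^ 5 * μ) with h | h
    · left
      rw [hsum]
      have h1 : r * (k : ℝ) ^ 2 = Real.sqrt V := by
        rw [hr, h]; field_simp
      have h2 : V = (r * (k : ℝ) ^ 2) ^ 2 := by rw [h1, Real.sq_sqrt hV0]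
      rw [h2]
      field_simp
    · right
      refine ⟨m.1, m.2, hm', ?_⟩
      rw [habs, ← hμ, hr, h]
      field_simp

theorem exists_acceptProb_sub_le : ∃ K : ℝ, 0 ≤ K ∧ ∀ (k : ℕ) (hk : 12 ^ 6 ≤ k) (M N : ℕ)
    (π : Fin k → Fin M → Fin N) (d : ℕ)
    (_ : ∀ p n, (Finset.univ.filter fun j => π p j = n).card ≤ d) (H : Fin k → Finset (Fin M))
    (_ : ∀ p q, ∀ i ∈ H p, ∀ j ∈ H q, π p i = π q j → p = q) (W : Fin k → Fin M → ℝ)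
    (_ : ∀ p, H p = Finset.univ ∨ (H p).card = k ^ 14)
    (_ : ∀ p, ∀ i ∈ H p, ∀ j ∉ H p, |W p j| ≤ |W p i|) (θ : ℝ),
    acceptProb hk π true W θ - acceptProb hk π false W θ ≤ K / k +
      K * (k : ℝ) ^ 11 * (d : ℝ) ^ 3 * ∑ p, collisionRatio (π p) (H p)ᶜ (W p) := by
  obtain ⟨K, hK, hφ⟩ := exists_hasTaylorBound_smoothTransition
  refine ⟨16 * K + 80, by positivity, fun k hk M N π d hd H hH W hcard htop θ => ?_⟩
  have hsum : 0 ≤ ∑ p, collisionRatio (π p) (H p)ᶜ (W p) :=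
    Finset.sum_nonneg fun p _ => collisionRatio_nonneg _ _ _
  by_cases hW : ∃ p, ∃ j ∉ H p, W p j ≠ 0
  · obtain ⟨s, hs, hn⟩ := exists_pos_isNormalized_smul (le_trans (by norm_num) hk) H W hW
    have h := acceptProb_sub_le_of_isNormalized hk hK hφ π hd H hH _ hn hcard
      (fun p i hi j hj => by
        rw [abs_mul, abs_mul]
        exact mul_le_mul_of_nonneg_left (htop p i hi j hj) (abs_nonneg _)) (s * θ)
    rw [acceptProb_smul hk π _ W θ hs, acceptProb_smul hk π _ W θ hs] at h
    simp only [collisionRatio_smul _ _ _ hs] at h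
    refine h.trans ?_
    gcongr
    linarith
  · push Not at hW
    refine (acceptProb_sub_le_of_eq_zero hk hK hφ π H hH W hW θ).trans ?_
    positivity

end

section

variable {k M N : ℕ}

/-! ### Decoding labelings -/

theorem exists_finset_top {α : Type*} [Fintype α] [DecidableEq α] (f : α → ℝ) (t : ℕ) :
    ∃ H : Finset α, H.card ≤ t ∧ (H = Finset.univ ∨ H.card = t) ∧
      ∀ i ∈ H, ∀ j ∉ H, f j ≤ f i := by
  induction t with
  | zero => exact ⟨∅, by simp⟩
  | succ t ih =>
    obtain ⟨H, hle, hH, htop⟩ := ih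
    by_cases hu : H = Finset.univ
    · exact ⟨H, by omega, Or.inl hu, htop⟩
    · have hne : Hᶜ.Nonempty := Finset.nonempty_iff_ne_empty.2 (by simpa using hu)
      obtain ⟨m, hm, hmax⟩ := Finset.exists_max_image Hᶜ f hne
      have hm' : m ∉ H := Finset.mem_compl.1 hm
      have hc : (insert m H).card = t + 1 := by
        rw [Finset.card_insert_of_notMem hm', hH.resolve_left hu]
      refine ⟨insert m H, hc.le, Or.inr hc, fun i hi j hj => ?_⟩
      have hj' : j ∉ H := fun h => hj (Finset.mem_insert_of_mem h)
      rcases Finset.mem_insert.1 hi with rfl | hi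
      · exact hmax j (Finset.mem_compl.2 hj')
      · exact htop i hi j hj'

theorem expect_uniformOfFinset_eq {α : Type*} [Fintype α] [DecidableEq α] (s : Finset α)
    (hs : s.Nonempty) {i : α} (hi : i ∈ s) :
    expect (PMF.uniformOfFinset s hs) (fun a => if a = i then (1 : ℝ) else 0) =
      (s.card : ℝ)⁻¹ := by
  simp [expect_eq_sum, PMF.uniformOfFinset_apply, hi]

namespace KLabelCover

variable {V E : Type*} (L : KLabelCover k M N V E)

/-- Labels from the lists `H` for two different vertices of `e` have the same projection. -/
def ListsCollide (H : V → Finset (Fin M)) (e : E) : Prop :=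
  ∃ p q, p ≠ q ∧ ∃ i ∈ H (L.vert e p), ∃ j ∈ H (L.vert e q), L.proj e p i = L.proj e q j

open scoped Classical in
-- Draw labels independently and uniformly from the lists. A colliding pair is hit with probability
-- at least `t⁻²`, and the best labeling does at least as well as the average.
theorem exists_labeling [Fintype V] [Fintype E] (H : V → Finset (Fin M))
    (hne : ∀ v, (H v).Nonempty) {t : ℕ} (ht : ∀ v, (H v).card ≤ t) :
    ∃ Λ : V → Fin M, ((Finset.univ.filter fun e => L.ListsCollide H e).card : ℝ) ≤
      (t : ℝ) ^ 2 * (Finset.univ.filter fun e => L.WeaklySatisfies Λ e).card := by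
  set P : PMF (V → Fin M) := piPMF fun v => PMF.uniformOfFinset (H v) (hne v) with hP
  have hMpos : 0 < M := lt_of_lt_of_le L.N_pos L.N_le_M
  have : Nonempty (Fin M) := ⟨⟨0, hMpos⟩⟩
  obtain ⟨Λ₀, hΛ₀⟩ := Finite.exists_max fun Λ : V → Fin M =>
    ((Finset.univ.filter fun e => L.WeaklySatisfies Λ e).card : ℝ)
  refine ⟨Λ₀, ?_⟩
  have hcard : ∀ Λ : V → Fin M, ((Finset.univ.filter fun e => L.WeaklySatisfies Λ e).card : ℝ) =
      ∑ e, if L.WeaklySatisfies Λ e then (1 : ℝ) else 0 := fun Λ => by simp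
  have hprob : ∀ e, (if L.ListsCollide H e then (1 : ℝ) else 0) ≤
      (t : ℝ) ^ 2 * expect P fun Λ => if L.WeaklySatisfies Λ e then (1 : ℝ) else 0 := by
    intro e
    have hnn : 0 ≤ expect P fun Λ => if L.WeaklySatisfies Λ e then (1 : ℝ) else 0 :=
      expect_nonneg _ fun Λ => by positivity
    split_ifs with he
    · obtain ⟨p, q, hpq, i, hi, j, hj, hij⟩ := he
      have hv : L.vert e p ≠ L.vert e q := fun h => hpq (L.vert_injective e h)
      -- The event that `v_p` gets `i` and `v_q` gets `j`, written as a product over all vertices so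
      -- that its expectation factors.
      set g : V → Fin M → ℝ := fun v a => if v = L.vert e p then (if a = i then 1 else 0)
        else if v = L.vert e q then (if a = j then 1 else 0) else 1 with hg
      have hg01 : ∀ v a, 0 ≤ g v a ∧ g v a ≤ 1 := fun v a => by
        simp only [hg]; split_ifs <;> norm_num
      have hpt : ∀ Λ : V → Fin M, ∏ v, g v (Λ v) ≤
          if L.WeaklySatisfies Λ e then (1 : ℝ) else 0 := by
        intro Λ
        split_ifs with hw
        · exact Finset.prod_le_one (fun v _ => (hg01 v _).1) fun v _ => (hg01 v _).2
        · refine le_of_eq ?_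
          by_cases h1 : Λ (L.vert e p) = i
          · refine Finset.prod_eq_zero (Finset.mem_univ (L.vert e q)) ?_
            have h2 : Λ (L.vert e q) ≠ j := fun h2 => hw ⟨p, q, hv, by rw [h1, h2, hij]⟩
            simp [hg, hv.symm, h2]
          · refine Finset.prod_eq_zero (Finset.mem_univ (L.vert e p)) ?_
            simp [hg, h1]
      have hE : expect P (fun Λ => ∏ v, g v (Λ v)) =
          ((H (L.vert e p)).card : ℝ)⁻¹ * ((H (L.vert e q)).card : ℝ)⁻¹ := by
        rw [hP, expect_piPMF_prod, Finset.prod_eq_mul (L.vert e p) (L.vert e q) hv]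
        · congr 1
          · simp only [hg, if_true]
            exact expect_uniformOfFinset_eq _ _ hi
          · simp only [hg, hv.symm, if_true, if_false]
            exact expect_uniformOfFinset_eq _ _ hj
        · intro v _ hvv
          simp only [hg, hvv.1, hvv.2, if_false]
          exact expect_const _ _
        · simp
        · simp
      have hle := hE.symm.trans_le (expect_mono P hpt)
      have hinv : ∀ v, 1 ≤ (t : ℝ) * ((H v).card : ℝ)⁻¹ := fun v => by
        have h1 : (0 : ℝ) < (H v).card := by exact_mod_cast (hne v).card_pos
        rw [← div_eq_mul_inv, le_div_iff₀ h1, one_mul]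
        exact_mod_cast ht v
      calc (1 : ℝ) ≤ ((t : ℝ) * ((H (L.vert e p)).card : ℝ)⁻¹) *
            ((t : ℝ) * ((H (L.vert e q)).card : ℝ)⁻¹) :=
            one_le_mul_of_one_le_of_one_le (hinv _) (hinv _)
        _ = (t : ℝ) ^ 2 * (((H (L.vert e p)).card : ℝ)⁻¹ * ((H (L.vert e q)).card : ℝ)⁻¹) := by
            ring
        _ ≤ _ := mul_le_mul_of_nonneg_left hle (by positivity)
    · positivity
  calc ((Finset.univ.filter fun e => L.ListsCollide H e).card : ℝ)
      = ∑ e, if L.ListsCollide H e then (1 : ℝ) else 0 := by simp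
    _ ≤ ∑ e, (t : ℝ) ^ 2 * expect P fun Λ => if L.WeaklySatisfies Λ e then (1 : ℝ) else 0 :=
        Finset.sum_le_sum fun e _ => hprob e
    _ = (t : ℝ) ^ 2 * expect P fun Λ =>
          ((Finset.univ.filter fun e => L.WeaklySatisfies Λ e).card : ℝ) := by
        rw [← Finset.mul_sum, ← expect_sum]
        simp only [hcard]
    _ ≤ _ := mul_le_mul_of_nonneg_left (expect_le P hΛ₀) (by positivity)

/-! ### Smoothness bounds the collision ratios on average -/

/-- At a fixed vertex the denominator does not depend on the hyperedge, and each pair of distinct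
labels collides in at most a `1 / J` fraction of the incident hyperedges. -/
theorem sum_collisionRatio_le [Fintype V] [Fintype E] {J d : ℕ} (hL : L.Smooth J d)
    (R : V → Finset (Fin M)) (w : V → Fin M → ℝ) :
    ∑ e, ∑ p, collisionRatio (L.proj e p) (R (L.vert e p)) (w (L.vert e p)) ≤
      Fintype.card E * k / J := by
  classical
  have hv : ∀ v, ∑ c : E × Fin k with L.vert c.1 c.2 = v,
      collisionRatio (L.proj c.1 c.2) (R (L.vert c.1 c.2)) (w (L.vert c.1 c.2)) ≤
      ((Finset.univ.filter fun c : E × Fin k => L.vert c.1 c.2 = v).card : ℝ) / J := by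
    intro v
    set S := Finset.univ.filter fun c : E × Fin k => L.vert c.1 c.2 = v with hS
    set Q : ℝ := ∑ i ∈ R v, w v i ^ 2 with hQ
    have h1 : ∑ c ∈ S, collisionRatio (L.proj c.1 c.2) (R (L.vert c.1 c.2)) (w (L.vert c.1 c.2)) =
        (∑ c ∈ S, collisionWeight (L.proj c.1 c.2) (R v) (w v)) / Q ^ 2 := by
      rw [Finset.sum_div]
      refine Finset.sum_congr rfl fun c hc => ?_
      rw [(Finset.mem_filter.1 hc).2, collisionRatio]
    have h2 : ∑ c ∈ S, collisionWeight (L.proj c.1 c.2) (R v) (w v) ≤ S.card / J * Q ^ 2 := by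
      simp only [collisionWeight]
      rw [Finset.sum_comm, sq Q, hQ, Finset.sum_mul_sum, Finset.mul_sum]
      refine Finset.sum_le_sum fun i _ => ?_
      rw [Finset.sum_comm, Finset.mul_sum]
      refine Finset.sum_le_sum fun j _ => ?_
      by_cases hij : i = j
      · simp only [hij, ne_eq, not_true_eq_false, false_and, if_false, Finset.sum_const_zero]
        positivity
      · have h3 := hL.1 v i j hij
        have h4 : ((Finset.univ.filter fun c : E × Fin k => L.vert c.1 c.2 = v ∧
            L.proj c.1 c.2 i = L.proj c.1 c.2 j).card : ℝ) ≤ S.card / J := by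
          have h5 : ((Finset.univ.filter fun c : E × Fin k => L.vert c.1 c.2 = v ∧
            L.proj c.1 c.2 i = L.proj c.1 c.2 j).card : ℝ) / S.card ≤ 1 / J := by
            convert h3
          rcases S.card.eq_zero_or_pos with h0 | h0
          · rw [h0, Nat.cast_zero, zero_div]
            have : (Finset.univ.filter fun c : E × Fin k => L.vert c.1 c.2 = v ∧
                L.proj c.1 c.2 i = L.proj c.1 c.2 j).card ≤ S.card :=
              Finset.card_le_card fun c hc => by
                simp only [hS, Finset.mem_filter] at hc ⊢
                exact ⟨hc.1, hc.2.1⟩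
            rw [h0] at this
            exact_mod_cast this
          · have h0' : (0 : ℝ) < S.card := by exact_mod_cast h0
            rw [div_le_iff₀ h0'] at h5
            rwa [div_eq_mul_one_div, mul_comm]
        have h6 : (∑ c ∈ S, if i ≠ j ∧ L.proj c.1 c.2 i = L.proj c.1 c.2 j then
            w v i ^ 2 * w v j ^ 2 else 0) = ((Finset.univ.filter fun c : E × Fin k =>
              L.vert c.1 c.2 = v ∧ L.proj c.1 c.2 i = L.proj c.1 c.2 j).card : ℝ) *
            (w v i ^ 2 * w v j ^ 2) := by
          simp only [ne_eq, hij, not_false_eq_true, true_and]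
          rw [← Finset.sum_filter, Finset.sum_const, nsmul_eq_mul, hS, Finset.filter_filter]
        refine (le_of_eq ?_).trans ((le_of_eq h6).trans
          (mul_le_mul_of_nonneg_right h4 (by positivity)))
        congr!
    rw [h1]
    rcases eq_or_ne (Q ^ 2) 0 with h0 | h0
    · rw [h0, div_zero]
      positivity
    · have : 0 < Q ^ 2 := lt_of_le_of_ne (sq_nonneg _) h0.symm
      rw [div_le_iff₀ this]
      exact h2
  rw [← Fintype.sum_prod_type' (f := fun e p =>
    collisionRatio (L.proj e p) (R (L.vert e p)) (w (L.vert e p))),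
    ← Finset.sum_fiberwise Finset.univ fun c : E × Fin k => L.vert c.1 c.2]
  refine (Finset.sum_le_sum fun v _ => hv v).trans (le_of_eq ?_)
  have hcard := Finset.card_eq_sum_card_fiberwise (s := Finset.univ) (t := Finset.univ)
    (f := fun c : E × Fin k => L.vert c.1 c.2) fun _ _ => Finset.mem_univ _
  rw [← Finset.sum_div, ← Nat.cast_sum, ← hcard]
  simp

end KLabelCover

/-! ### Soundness -/

theorem acceptProb_le_one (hk : 12 ^ 6 ≤ k) (π : Fin k → Fin M → Fin N) (b : Bool)
    (W : Fin k → Fin M → ℝ) (θ : ℝ) : acceptProb hk π b W θ ≤ 1 :=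
  blockExpect_le hk π b fun z => by split_ifs <;> norm_num

theorem acceptProb_nonneg (hk : 12 ^ 6 ≤ k) (π : Fin k → Fin M → Fin N) (b : Bool)
    (W : Fin k → Fin M → ℝ) (θ : ℝ) : 0 ≤ acceptProb hk π b W θ :=
  blockExpect_nonneg hk π b fun z => by positivity

theorem KLabelCover.agreement_halfspace {V E : Type*} (L : KLabelCover k M N V E) [Fintype V]
    [Fintype E] (hk : 12 ^ 6 ≤ k) {h : (V × Fin M → Bool) → Bool} {w : V × Fin M → ℝ} {θ : ℝ}
    (hh : ∀ y, h y = true ↔ 0 ≤ (∑ i, w i * (if y i then 1 else 0)) - θ) :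
    agreement (L.exampleDist hk) h = 1 / 2 + (∑ e,
      (acceptProb hk (L.proj e) true (fun p j => w (L.vert e p, j)) θ -
        acceptProb hk (L.proj e) false (fun p j => w (L.vert e p, j)) θ)) /
        (2 * Fintype.card E) := by
  classical
  have hbit : ∀ e z, bit (h (L.extendBlocks e z)) =
      if θ ≤ blockSum (fun p j => w (L.vert e p, j)) z then 1 else 0 := by
    intro e z
    have h1 := hh (L.extendBlocks e z)
    have h2 := L.sum_extendBlocks e z w
    simp only [bit] at h2
    rw [h2, sub_nonneg] at h1
    change _ ↔ θ ≤ blockSum (fun p j => w (L.vert e p, j)) z at h1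
    by_cases h3 : h (L.extendBlocks e z) = true
    · rw [if_pos (h1.1 h3), h3, bit_true]
    · rw [if_neg fun h4 => h3 (h1.2 h4), Bool.eq_false_iff.2 h3, bit_false]
  have := L.nonempty_edges
  have hE : (Fintype.card E : ℝ) ≠ 0 := by exact_mod_cast Fintype.card_ne_zero
  rw [L.agreement_exampleDist]
  have hedge : ∀ e, (1 / 2 : ℝ) *
      (blockExpect hk (L.proj e) true (fun z => agreeInd (h (L.extendBlocks e z)) true) +
        blockExpect hk (L.proj e) false (fun z => agreeInd (h (L.extendBlocks e z)) false)) =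
      1 / 2 + (acceptProb hk (L.proj e) true (fun p j => w (L.vert e p, j)) θ -
        acceptProb hk (L.proj e) false (fun p j => w (L.vert e p, j)) θ) / 2 := by
    intro e
    simp only [agreeInd_true, agreeInd_false, hbit]
    have h4 : (blockExpect hk (L.proj e) false fun z =>
        1 - if θ ≤ blockSum (fun p j => w (L.vert e p, j)) z then (1 : ℝ) else 0) =
        1 - acceptProb hk (L.proj e) false (fun p j => w (L.vert e p, j)) θ := by
      simp only [blockExpect, expect_sub, expect_const, acceptProb]
    rw [h4]
    change 1 / 2 * (acceptProb hk (L.proj e) true (fun p j => w (L.vert e p, j)) θ + _) = _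
    ring
  simp only [hedge]
  rw [Finset.sum_add_distrib, Finset.sum_const, Finset.card_univ, nsmul_eq_mul, ← Finset.sum_div]
  field_simp

theorem exists_bound_pow_mul_rpow {γ : ℝ} (hγ : 0 < γ) (n : ℕ) :
    ∃ C : ℝ, 0 ≤ C ∧ ∀ k : ℕ, (k : ℝ) ^ n * (2 : ℝ) ^ (-(γ * k)) ≤ C := by
  have hr0 : 0 < (2 : ℝ) ^ (-γ) := by positivity
  have hr1 : (2 : ℝ) ^ (-γ) < 1 := Real.rpow_lt_one_of_one_lt_of_neg (by norm_num) (by linarith)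
  have ht := tendsto_pow_const_mul_const_pow_of_abs_lt_one n
    (show |(2 : ℝ) ^ (-γ)| < 1 by rwa [abs_of_pos hr0])
  obtain ⟨C, hC⟩ := ht.bddAbove_range
  refine ⟨max C 0, le_max_right _ _, fun k => le_max_of_le_left ?_⟩
  have h := hC ⟨k, rfl⟩
  have e : (2 : ℝ) ^ (-(γ * k)) = ((2 : ℝ) ^ (-γ)) ^ k := by
    rw [← Real.rpow_natCast, ← Real.rpow_mul (by norm_num)]
    congr 1
    ring
  rw [e]
  exact h

theorem soundness {γ : ℝ} (hγ : 0 < γ) : ∃ C : ℝ, ∀ (k : ℕ) (hk : 12 ^ 6 ≤ k) (M N : ℕ)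
    (V E : Type*) [Fintype V] [Fintype E] (L : KLabelCover k M N V E),
    L.Smooth (4 ^ (17 * k)) (4 ^ k) →
    ¬ L.WeaklySatisfiable (2 * (k : ℝ) ^ 2 * (2 : ℝ) ^ (-(γ * k))) →
    ∀ h : (V × Fin M → Bool) → Bool, IsHalfspace h →
      agreement (L.exampleDist hk) h ≤ 1 / 2 + C / Real.sqrt k := by
  classical
  obtain ⟨K, hK, hedge⟩ := exists_acceptProb_sub_le
  -- The exponent is 28 from the squared list size, 2 from the weak value, and 1 to gain a factor `1
  -- / k`.
  obtain ⟨C, hC, hpow⟩ := exists_bound_pow_mul_rpow hγ 31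
  refine ⟨2 * C + 2 * K, fun k hk M N V E _ _ L hsm hweak h ⟨w, θ, hh⟩ => ?_⟩
  have hk1 : 1 ≤ k := le_trans (by norm_num) hk
  have hk1' : (1 : ℝ) ≤ k := by exact_mod_cast hk1
  have hk0 : (0 : ℝ) < k := by linarith
  have := L.nonempty_edges
  have hE : (0 : ℝ) < Fintype.card E := by exact_mod_cast Fintype.card_pos
  -- The lists depend only on the weights at the vertex, so one choice serves all hyperedges.
  choose H hHle hHcard hHtop using fun v => exists_finset_top (fun j : Fin M => |w (v, j)|) (k ^ 14)
  have hMpos : 0 < M := lt_of_lt_of_le L.N_pos L.N_le_M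
  have hHne : ∀ v, (H v).Nonempty := fun v => by
    rcases hHcard v with h1 | h1
    · rw [h1]
      exact ⟨⟨0, hMpos⟩, Finset.mem_univ _⟩
    · exact Finset.card_pos.1 (by rw [h1]; positivity)
  set W : E → Fin k → Fin M → ℝ := fun e p j => w (L.vert e p, j) with hW
  set ratio : E → ℝ := fun e => ∑ p, collisionRatio (L.proj e p) (H (L.vert e p))ᶜ (W e p)
    with hratio
  have hratio0 : ∀ e, 0 ≤ ratio e := fun e => Finset.sum_nonneg fun p _ =>
    collisionRatio_nonneg _ _ _
  set D : ℝ := ((4 ^ k : ℕ) : ℝ) with hD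
  have hD0 : 0 < D := by rw [hD]; positivity
  have hpt : ∀ e, acceptProb hk (L.proj e) true (W e) θ - acceptProb hk (L.proj e) false (W e) θ ≤
      (if L.ListsCollide H e then (1 : ℝ) else 0) +
        (K / k + K * (k : ℝ) ^ 11 * D ^ 3 * ratio e) := by
    intro e
    have hr := hratio0 e
    split_ifs with he
    · have h1 := acceptProb_le_one hk (L.proj e) true (W e) θ
      have h2 := acceptProb_nonneg hk (L.proj e) false (W e) θ
      have h3 : 0 ≤ K / k + K * (k : ℝ) ^ 11 * D ^ 3 * ratio e := by positivity
      linarith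
    · rw [zero_add]
      refine hedge k hk M N (L.proj e) (4 ^ k) (fun p n => by convert hsm.2 e p n)
        (fun p => H (L.vert e p)) (fun p q i hi j hj hij => ?_) (W e)
        (fun p => hHcard _) (fun p i hi j hj => hHtop _ i hi j hj) θ
      by_contra hpq
      exact he ⟨p, q, hpq, i, hi, j, hj, hij⟩
  obtain ⟨Λ, hΛ⟩ := L.exists_labeling H hHne hHle
  have hbad : ∑ e, (if L.ListsCollide H e then (1 : ℝ) else 0) ≤
      Fintype.card E * (2 * C / k) := by
    have h1 : ((Finset.univ.filter fun e => L.WeaklySatisfies Λ e).card : ℝ) ≤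
        2 * (k : ℝ) ^ 2 * (2 : ℝ) ^ (-(γ * k)) * Fintype.card E := by
      by_contra! hc
      refine hweak ⟨Λ, ?_⟩
      rw [le_div_iff₀ hE]
      exact hc.le
    have h2 : (k : ℝ) ^ 30 * (2 : ℝ) ^ (-(γ * k)) ≤ C / k := by
      rw [le_div_iff₀ hk0]
      refine le_trans (le_of_eq ?_) (hpow k)
      ring
    calc ∑ e, (if L.ListsCollide H e then (1 : ℝ) else 0)
        = ((Finset.univ.filter fun e => L.ListsCollide H e).card : ℝ) := by simp
      _ ≤ ((k ^ 14 : ℕ) : ℝ) ^ 2 * (2 * (k : ℝ) ^ 2 * (2 : ℝ) ^ (-(γ * k)) * Fintype.card E) :=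
          hΛ.trans (mul_le_mul_of_nonneg_left h1 (by positivity))
      _ = Fintype.card E * (2 * ((k : ℝ) ^ 30 * (2 : ℝ) ^ (-(γ * k)))) := by push_cast; ring
      _ ≤ Fintype.card E * (2 * (C / k)) := by gcongr
      _ = _ := by ring
  have hcoll : K * (k : ℝ) ^ 11 * D ^ 3 * ∑ e, ratio e ≤ Fintype.card E * (K / k) := by
    have h1 : ∑ e, ratio e ≤ Fintype.card E * k / ((4 ^ (17 * k) : ℕ) : ℝ) :=
      L.sum_collisionRatio_le hsm (fun v => (H v)ᶜ) fun v j => w (v, j)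
    have h2 : ((4 ^ (17 * k) : ℕ) : ℝ) = D ^ 17 := by
      rw [hD]; push_cast; rw [← pow_mul, mul_comm]
    have h3 : (k : ℝ) ≤ D := by
      rw [hD]; exact_mod_cast (Nat.lt_pow_self (by norm_num)).le
    have h4 : (k : ℝ) ^ 13 ≤ D ^ 14 := by
      have h5 : (1 : ℝ) ≤ D := hk1'.trans h3
      calc (k : ℝ) ^ 13 ≤ D ^ 13 := by gcongr
        _ ≤ D ^ 14 := pow_le_pow_right₀ h5 (by norm_num)
    rw [h2] at h1
    calc K * (k : ℝ) ^ 11 * D ^ 3 * ∑ e, ratio e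
        ≤ K * (k : ℝ) ^ 11 * D ^ 3 * (Fintype.card E * k / D ^ 17) := by gcongr
      _ = Fintype.card E * (K / k) * ((k : ℝ) ^ 13 / D ^ 14) := by field_simp
      _ ≤ Fintype.card E * (K / k) * 1 := by
          refine mul_le_mul_of_nonneg_left ?_ (by positivity)
          rw [div_le_one (by positivity)]
          exact h4
      _ = _ := by ring
  have hsum : ∑ e, (acceptProb hk (L.proj e) true (W e) θ -
      acceptProb hk (L.proj e) false (W e) θ) ≤ Fintype.card E * ((2 * C + 2 * K) / k) := by
    refine (Finset.sum_le_sum fun e _ => hpt e).trans ?_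
    rw [Finset.sum_add_distrib, Finset.sum_add_distrib, ← Finset.mul_sum, Finset.sum_const,
      Finset.card_univ, nsmul_eq_mul]
    have e : Fintype.card E * ((2 * C + 2 * K) / k) = Fintype.card E * (2 * C / k) +
      (Fintype.card E * (K / k) + Fintype.card E * (K / k)) := by ring
    rw [e]
    gcongr
  rw [L.agreement_halfspace hk hh]
  have hsqrt : Real.sqrt k ≤ k := by
    rw [Real.sqrt_le_left hk0.le]
    nlinarith
  -- The argument gives an advantage of order `1 / k`; it is only now weakened to `1 / √k`.
  have hfin : (2 * C + 2 * K) / k ≤ (2 * C + 2 * K) / Real.sqrt k :=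
    div_le_div_of_nonneg_left (by positivity) (Real.sqrt_pos.2 hk0) hsqrt
  have hhalf : (∑ e, (acceptProb hk (L.proj e) true (W e) θ -
      acceptProb hk (L.proj e) false (W e) θ)) / (2 * Fintype.card E) ≤ (2 * C + 2 * K) / k := by
    rw [div_le_iff₀ (by positivity)]
    have h1 : 0 ≤ Fintype.card E * ((2 * C + 2 * K) / k) := by positivity
    linarith
  exact add_le_add_right (hhalf.trans hfin) _

end

end AgnosticHardness

theorem mainTheorem3 :
    -- completeness
    (∃ C : ℝ, ∀ (k : ℕ) (hk : 12 ^ 6 ≤ k) (M N : ℕ) (V E : Type*) [Fintype V] [Fintype E]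
      (L : AgnosticHardness.KLabelCover k M N V E),
      L.StronglySatisfiable →
      ∃ h : (V × Fin M → Bool) → Bool, AgnosticHardness.IsDisjunction h ∧
        1 - C / Real.sqrt k ≤ AgnosticHardness.agreement (L.exampleDist hk) h) ∧
    -- soundness
    (∀ γ : ℝ, 0 < γ → ∃ C : ℝ, ∀ (k : ℕ) (hk : 12 ^ 6 ≤ k) (M N : ℕ) (V E : Type*)
      [Fintype V] [Fintype E] (L : AgnosticHardness.KLabelCover k M N V E),
      L.Smooth (4 ^ (17 * k)) (4 ^ k) →
      ¬ L.WeaklySatisfiable (2 * (k : ℝ) ^ 2 * (2 : ℝ) ^ (-(γ * k))) →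
      ∀ h : (V × Fin M → Bool) → Bool, AgnosticHardness.IsHalfspace h →
        AgnosticHardness.agreement (L.exampleDist hk) h ≤ 1 / 2 + C / Real.sqrt k) := by
  exact ⟨⟨3, fun k hk M N V E _ _ L hL => AgnosticHardness.completeness k hk M N L hL⟩,
    fun _ hγ => AgnosticHardness.soundness hγ⟩
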